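/- Let $d\ge 1$ and $\Omega=(0,1)^d$. For an integer $N\ge1$, divide $\Omega$ (up to a null set) into the $N^d$ cubes $\Delta_j=\frac{j}{N}+(-\frac1N,0]^d$, $j\in\{1,\dots,N\}^d$, of side $1/N$; call this partition $\Xi_{1/N}$. Each cube contains the lower-left sub-cube $\Delta_j^L=\frac jN+(-\frac1N,-\frac1{2N}]^d$ and the upper-right sub-cube $\Delta_j^R=\frac jN+(-\frac1{2N},0]^d$. Let $P_0=\mathrm{Unif}(\Omega)$, let $P_{\Delta}$ be the distribution on $\Omega$ with density $1+\frac12(\mathbf 1_{\Delta^L}-\mathbf 1_{\Delta^R})$, and for $\eta$ with $1/\eta\in\mathbb N$ let $\mathcal P_\eta=\{(P_0,P_\Delta):\Delta\in\Xi_\eta\}$. In the Poisson observation model with intensity $n$, $n_1,n_2\sim\mathrm{Pois}(n)$, $X_1,X_2,\dots\sim P$ and $Y_1,Y_2,\dots\sim Q$ are all independent, and $X_1,\dots,X_{n_1},Y_1,\dots,Y_{n_2}$ are observed. For a binwidth $\varepsilon$ with $1/\varepsilon\in\mathbb N$ let $$\mathcal K_\varepsilon=\sum_{\Delta\in\Xi_\varepsilon}\bigl(\#\{i\le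 n_1:X_i\in\Delta\}-\#\{i\le n_2:Y_i\in\Delta\}\bigr)^2,$$ and let $\varphi=\mathbf 1\{\mathcal K_\varepsilon>t\}$ be the $\chi^2$-type test with threshold $t$. Let $z^\alpha$ be the $(1-\alpha)$ quantile of the standard normal distribution. There is a constant $c>0$ depending only on $d$, and for every $\alpha\in(0,\frac12)$ a constant $N$ depending only on $d$ and $\alpha$, such that the following holds for all $n\ge N$, all binwidths $\varepsilon$ with $1/\varepsilon\in\mathbb N$, and all thresholds $t$ for which $\mathbb E_{P_0,P_0}[\varphi]\le\alpha$. (1) Spatially localized alternatives: for every $\eta$ with $1/\eta\in\mathbb N$ and $\eta\le c\,n^{-2/(3d)}$ there is $(P,Q)\in\mathcal P_\eta$ with $\mathbb E_{P,Q}[\varphi]\le 2/(z^\alpha)^2$. (2) Alternatives separated in the TV IPM: for every $\rho\le c\,n^{-2/(3d)}$ there are distributions $P,Q$ on $\Omega$ with densities $p,q$ that satisfy, for every $B\ge2$, $|p-q|\le B$ and $\frac1B\le wp+(1-w)q\le B$ on $\Omega$ for all $w\in[0,1]$, such that $d_{\mathrm{BV}}(P,Q)\ge\rho$ and $\mathbb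 E_{P,Q}[\varphi]\le 2/(z^\alpha)^2$. Here $d_{\mathrm{BV}}(P,Q)=\sup\{\mathbb E_P f-\mathbb E_Q f: f\in L^1(\mathbb R^d),\ \mathrm{TV}(f)\le1\}$ and $\mathrm{TV}(f)=\sup\{\int f\,\mathrm{div}\,\phi:\phi\in C^1_c(\mathbb R^d;\mathbb R^d),\ \|\phi(x)\|_2\le1\text{ for all }x\}$. -/

import Mathlib

open MeasureTheory ProbabilityTheory
open scoped NNReal ENNReal

noncomputable section

namespace ChiSq

/-- The domain `Ω = (0,1)^d`, as a subset of `ℝ^d`. Points of `ℝ^d` are functions `Fin d → ℝ`;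
only Lebesgue measure and coordinates are used, never the ambient (sup) norm. -/
def unitCube (d : ℕ) : Set (Fin d → ℝ) := Set.univ.pi fun _ => Set.Ioo (0 : ℝ) 1

/-- The cube `Δ_j` of side `1/N`: in coordinate `i` it is `(j_i/N, (j_i+1)/N]`. The indices run
over `{0,…,N-1}^d`, and the cubes partition `(0,1]^d`. -/
def cell {d : ℕ} (N : ℕ) (j : Fin d → Fin N) : Set (Fin d → ℝ) :=
  Set.univ.pi fun i => Set.Ioc ((j i : ℝ) / N) (((j i : ℝ) + 1) / N)

/-- The lower-left sub-cube `Δ_j^L`, of side `1/(2N)`. -/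
def cellL {d : ℕ} (N : ℕ) (j : Fin d → Fin N) : Set (Fin d → ℝ) :=
  Set.univ.pi fun i => Set.Ioc ((j i : ℝ) / N) (((j i : ℝ) + 1 / 2) / N)

/-- The upper-right sub-cube `Δ_j^R`, of side `1/(2N)`. -/
def cellR {d : ℕ} (N : ℕ) (j : Fin d → Fin N) : Set (Fin d → ℝ) :=
  Set.univ.pi fun i => Set.Ioc (((j i : ℝ) + 1 / 2) / N) (((j i : ℝ) + 1) / N)

/-- `φ_Δ = 1_{Δ^L} - 1_{Δ^R}`. -/
def bump {d : ℕ} (N : ℕ) (j : Fin d → Fin N) (x : Fin d → ℝ) : ℝ :=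
  (cellL N j).indicator (fun _ => (1 : ℝ)) x - (cellR N j).indicator (fun _ => (1 : ℝ)) x

/-- The uniform distribution on `Ω`, as a measure. -/
def unifMeasure (d : ℕ) : Measure (Fin d → ℝ) := volume.restrict (unitCube d)

/-- The measure on `Ω` with density `1 + φ_Δ / 2`. -/
def bumpMeasure {d : ℕ} (N : ℕ) (j : Fin d → Fin N) : Measure (Fin d → ℝ) :=
  (unifMeasure d).withDensity fun x => ENNReal.ofReal (1 + 1 / 2 * bump N j x)

instance instUnif (d : ℕ) : IsProbabilityMeasure (unifMeasure d) := ⟨by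
  rw [unifMeasure, Measure.restrict_apply_univ, unitCube, Real.volume_pi_Ioo]
  simp⟩

theorem measurableSet_cellL {d : ℕ} (N : ℕ) (j : Fin d → Fin N) : MeasurableSet (cellL N j) :=
  MeasurableSet.univ_pi fun _ => measurableSet_Ioc

theorem measurableSet_cellR {d : ℕ} (N : ℕ) (j : Fin d → Fin N) : MeasurableSet (cellR N j) :=
  MeasurableSet.univ_pi fun _ => measurableSet_Ioc

theorem unif_box {d : ℕ} (a b : Fin d → ℝ) (ha : ∀ i, 0 ≤ a i) (hb : ∀ i, b i ≤ 1) :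
    unifMeasure d (Set.univ.pi fun i => Set.Ioc (a i) (b i))
      = ∏ i, ENNReal.ofReal (b i - a i) := by
  have h : (unitCube d : Set (Fin d → ℝ)) =ᵐ[volume] Set.univ.pi fun _ => Set.Ioc (0 : ℝ) 1 :=
    (Measure.univ_pi_Ioo_ae_eq_Icc (f := fun _ => (0 : ℝ)) (g := fun _ => (1 : ℝ))).trans
      (Measure.univ_pi_Ioc_ae_eq_Icc (f := fun _ => (0 : ℝ)) (g := fun _ => (1 : ℝ))).symm
  rw [unifMeasure, Measure.restrict_congr_set h,
    Measure.restrict_apply (MeasurableSet.univ_pi fun _ => measurableSet_Ioc),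
    Set.inter_eq_left.2, Real.volume_pi_Ioc]
  exact Set.pi_mono fun i _ => Set.Ioc_subset_Ioc (ha i) (hb i)

theorem unif_cellL_eq_cellR {d : ℕ} (N : ℕ) (j : Fin d → Fin N) :
    unifMeasure d (cellL N j) = unifMeasure d (cellR N j) := by
  have hN : ∀ i, (0 : ℝ) < N := fun i => by
    have := (j i).2
    exact_mod_cast (Nat.zero_le _).trans_lt this
  have hj : ∀ i, (j i : ℝ) + 1 ≤ N := fun i => by exact_mod_cast (j i).2
  rw [cellL, cellR, unif_box, unif_box]
  · refine Finset.prod_congr rfl fun i _ => ?_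
    congr 1
    ring
  · intro i
    have := hN i
    positivity
  · intro i
    exact (div_le_one (hN i)).2 (hj i)
  · intro i
    have := hN i
    positivity
  · intro i
    exact (div_le_one (hN i)).2 (by linarith [hj i])

theorem bump_ge {d : ℕ} (N : ℕ) (j : Fin d → Fin N) (x : Fin d → ℝ) : -1 ≤ bump N j x := by
  have h1 : 0 ≤ (cellL N j).indicator (fun _ => (1 : ℝ)) x :=
    Set.indicator_nonneg (fun _ _ => zero_le_one) x
  have h2 : (cellR N j).indicator (fun _ => (1 : ℝ)) x ≤ 1 :=
    Set.indicator_le_self' (fun _ _ => zero_le_one) x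
  unfold bump
  linarith

instance instBump {d : ℕ} (N : ℕ) (j : Fin d → Fin N) :
    IsProbabilityMeasure (bumpMeasure N j) := ⟨by
  have hL := (integrable_const (μ := unifMeasure d) (1 : ℝ)).indicator (measurableSet_cellL N j)
  have hR := (integrable_const (μ := unifMeasure d) (1 : ℝ)).indicator (measurableSet_cellR N j)
  have hb : Integrable (bump N j) (unifMeasure d) := hL.sub hR
  have h0 : ∫ x, bump N j x ∂(unifMeasure d) = 0 := by
    unfold bump
    rw [integral_sub hL hR, integral_indicator_const _ (measurableSet_cellL N j),
      integral_indicator_const _ (measurableSet_cellR N j), measureReal_def, measureReal_def,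
      unif_cellL_eq_cellR, sub_self]
  have hi : Integrable (fun x => 1 + 1 / 2 * bump N j x) (unifMeasure d) :=
    (integrable_const _).add (hb.const_mul _)
  rw [bumpMeasure, withDensity_apply _ MeasurableSet.univ, Measure.restrict_univ,
    ← ofReal_integral_eq_lintegral_ofReal hi (Filter.Eventually.of_forall fun x => by
        have := bump_ge N j x
        simp only [Pi.zero_apply]
        linarith),
    integral_add (integrable_const _) (hb.const_mul _), integral_const_mul, h0]
  simp⟩

/-- `P_0 = Unif(Ω)`. -/
def unif (d : ℕ) : ProbabilityMeasure (Fin d → ℝ) := ⟨unifMeasure d, inferInstance⟩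

/-- `P_Δ`, the distribution with density `1 + φ_Δ / 2` on `Ω`. -/
def bumped {d : ℕ} (N : ℕ) (j : Fin d → Fin N) : ProbabilityMeasure (Fin d → ℝ) :=
  ⟨bumpMeasure N j, inferInstance⟩

/-- The spatially localized family `𝒫_η` with `η = 1/m`: all pairs `(P_0, P_Δ)`, where `Δ` runs
over the cubes of side `1/m`. -/
def localizedFamily (d m : ℕ) :
    Set (ProbabilityMeasure (Fin d → ℝ) × ProbabilityMeasure (Fin d → ℝ)) :=
  Set.range fun j : Fin d → Fin m => (unif d, bumped m j)

/-- Outcomes of the Poissonized experiment: the sample sizes `n₁, n₂` and two sequences, of which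
`X_1,…,X_{n₁}` and `Y_1,…,Y_{n₂}` (here indexed from `0`) are observed. -/
structure Outcome (d : ℕ) where
  n₁ : ℕ
  n₂ : ℕ
  X : ℕ → Fin d → ℝ
  Y : ℕ → Fin d → ℝ

/-- Reading an outcome off a point of the product space. -/
def Outcome.ofProd {d : ℕ} (ω : (ℕ × ℕ) × ((ℕ → Fin d → ℝ) × (ℕ → Fin d → ℝ))) : Outcome d :=
  ⟨ω.1.1, ω.1.2, ω.2.1, ω.2.2⟩

/-- The Poisson observation model: `n₁, n₂ ∼ Pois(n)`, `X_i ∼ P`, `Y_i ∼ Q`, all independent. -/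
def poissonModel {d : ℕ} (n : ℝ≥0) (P Q : ProbabilityMeasure (Fin d → ℝ)) :
    Measure ((ℕ × ℕ) × ((ℕ → Fin d → ℝ) × (ℕ → Fin d → ℝ))) :=
  ((poissonMeasure n).prod (poissonMeasure n)).prod
    ((Measure.infinitePi fun _ : ℕ => (P : Measure (Fin d → ℝ))).prod
      (Measure.infinitePi fun _ : ℕ => (Q : Measure (Fin d → ℝ))))

/-- The number of the first `k` points of the sequence `x` that lie in `A`. -/
def count {d : ℕ} (k : ℕ) (x : ℕ → Fin d → ℝ) (A : Set (Fin d → ℝ)) : ℝ :=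
  ∑ i ∈ Finset.range k, A.indicator (fun _ => (1 : ℝ)) (x i)

/-- The `χ²`-type statistic with binwidth `1/M`. -/
def chiSqStat {d : ℕ} (M : ℕ) (o : Outcome d) : ℝ :=
  ∑ j : Fin d → Fin M, (count o.n₁ o.X (cell M j) - count o.n₂ o.Y (cell M j)) ^ 2

/-- The `χ²`-type test with binwidth `1/M` and threshold `t`: it rejects (value `1`) when the
statistic is greater than `t`. -/
def chiSqTest {d : ℕ} (M : ℕ) (t : ℝ) (o : Outcome d) : ℝ :=
  {o' : Outcome d | t < chiSqStat M o'}.indicator (fun _ => (1 : ℝ)) o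

/-- The probability `E_{P,Q}[φ]` that the test rejects, in the Poisson observation model. -/
def rejectionProb {d : ℕ} (n : ℝ≥0) (P Q : ProbabilityMeasure (Fin d → ℝ)) (M : ℕ) (t : ℝ) : ℝ :=
  ∫ ω, chiSqTest M t (Outcome.ofProd ω) ∂(poissonModel n P Q)

theorem measurable_count {d : ℕ} {A : Set (Fin d → ℝ)} (hA : MeasurableSet A) :
    Measurable fun p : ℕ × (ℕ → Fin d → ℝ) => count p.1 p.2 A := by
  refine measurable_from_prod_countable_right fun k => ?_
  have h : ∀ i, Measurable fun y : ℕ → Fin d → ℝ => A.indicator (fun _ => (1 : ℝ)) (y i) :=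
    fun i => (measurable_const.indicator hA).comp (measurable_pi_apply i)
  exact Finset.measurable_fun_sum (Finset.range k) fun i _ => h i

/-- The statistic is a measurable function of the outcome, so the test is integrable and
`rejectionProb` is the probability of rejection. -/
theorem measurable_chiSqStat {d : ℕ} (M : ℕ) :
    Measurable fun ω : (ℕ × ℕ) × ((ℕ → Fin d → ℝ) × (ℕ → Fin d → ℝ)) =>
      chiSqStat M (Outcome.ofProd ω) := by
  unfold chiSqStat Outcome.ofProd
  refine Finset.measurable_fun_sum _ fun j _ => ?_
  have hA : MeasurableSet (cell M j) := MeasurableSet.univ_pi fun _ => measurableSet_Ioc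
  have h1 := (measurable_count hA).comp
    (f := fun ω : (ℕ × ℕ) × ((ℕ → Fin d → ℝ) × (ℕ → Fin d → ℝ)) => (ω.1.1, ω.2.1)) (by fun_prop)
  have h2 := (measurable_count hA).comp
    (f := fun ω : (ℕ × ℕ) × ((ℕ → Fin d → ℝ) × (ℕ → Fin d → ℝ)) => (ω.1.2, ω.2.2)) (by fun_prop)
  exact (h1.sub h2).pow_const 2

theorem rejectionProb_eq {d : ℕ} (n : ℝ≥0) (P Q : ProbabilityMeasure (Fin d → ℝ)) (M : ℕ)
    (t : ℝ) : rejectionProb n P Q M t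
      = (poissonModel n P Q).real {ω | t < chiSqStat M (Outcome.ofProd ω)} := by
  have hs : MeasurableSet {ω : (ℕ × ℕ) × ((ℕ → Fin d → ℝ) × (ℕ → Fin d → ℝ)) |
      t < chiSqStat M (Outcome.ofProd ω)} :=
    measurableSet_lt measurable_const (measurable_chiSqStat M)
  exact integral_indicator_one hs

/-- The `(1 - α)` quantile `z^α` of the standard normal distribution. -/
def normalQuantile (α : ℝ) : ℝ := sInf {x : ℝ | 1 - α ≤ cdf (gaussianReal 0 1) x}

/-- Divergence of a vector field on `ℝ^d`. -/
def divergence {d : ℕ} (φ : (Fin d → ℝ) → (Fin d → ℝ)) (x : Fin d → ℝ) : ℝ :=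
  ∑ i, fderiv ℝ φ x (Pi.single i 1) i

/-- The fields admitted in the definition of total variation: `C¹`, compactly supported, and of
Euclidean length at most `1` everywhere. -/
def testFields (d : ℕ) : Set ((Fin d → ℝ) → (Fin d → ℝ)) :=
  {φ | ContDiff ℝ 1 φ ∧ HasCompactSupport φ ∧ ∀ x, ∑ i, φ x i ^ 2 ≤ 1}

/-- The total variation `sup_φ ∫ f div φ` of a function (used for integrable `f` only). -/
def totalVariation {d : ℕ} (f : (Fin d → ℝ) → ℝ) : EReal :=
  ⨆ φ ∈ testFields d, ((∫ x, f x * divergence φ x : ℝ) : EReal)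

/-- The total variation IPM `d_BV(P,Q)`: the supremum of `E_P f - E_Q f` over `f ∈ L¹(ℝ^d)` with
`TV(f) ≤ 1` (and for which both expectations exist, which is automatic when the densities of
`P` and `Q` are bounded). -/
def dBV {d : ℕ} (P Q : ProbabilityMeasure (Fin d → ℝ)) : EReal :=
  ⨆ f ∈ {f : (Fin d → ℝ) → ℝ | Integrable f ∧ totalVariation f ≤ 1 ∧
      Integrable f (P : Measure (Fin d → ℝ)) ∧ Integrable f (Q : Measure (Fin d → ℝ))},
    ((∫ x, f x ∂(P : Measure (Fin d → ℝ)) - ∫ x, f x ∂(Q : Measure (Fin d → ℝ)) : ℝ) : EReal)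

/-- The regularity class `𝒫^∞(d, B)`: `P` and `Q` live on `Ω` and have densities `p`, `q` such that
on `Ω` the difference `p - q` is bounded by `B` and the mixture `w p + (1 - w) q` lies between
`1/B` and `B`. The weight `w` is `n₁/(n₁+n₂)`; as the sample sizes are random here, the bounds are
asked for all weights `w ∈ [0,1]`, that is, whatever the sample sizes. -/
def regularClass (d : ℕ) (B : ℝ) :
    Set (ProbabilityMeasure (Fin d → ℝ) × ProbabilityMeasure (Fin d → ℝ)) :=
  {PQ | (PQ.1 : Measure (Fin d → ℝ)) (unitCube d)ᶜ = 0 ∧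
    (PQ.2 : Measure (Fin d → ℝ)) (unitCube d)ᶜ = 0 ∧
    ∃ p q : (Fin d → ℝ) → ℝ, Measurable p ∧ Measurable q ∧ (∀ x, 0 ≤ p x) ∧ (∀ x, 0 ≤ q x) ∧
      (PQ.1 : Measure (Fin d → ℝ)) = volume.withDensity (fun x => ENNReal.ofReal (p x)) ∧
      (PQ.2 : Measure (Fin d → ℝ)) = volume.withDensity (fun x => ENNReal.ofReal (q x)) ∧
      ∀ x ∈ unitCube d, |p x - q x| ≤ B ∧
        ∀ w ∈ Set.Icc (0 : ℝ) 1, 1 / B ≤ w * p x + (1 - w) * q x ∧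
          w * p x + (1 - w) * q x ≤ B}

end ChiSq

end

namespace ChiSq

/-! Poisson splitting makes the differences of the bin counts independent, each a difference of two
Poisson variables (`map_countDiff_poissonModel`). With `R = M ^ d` bins and `a = n / R`, the null
statistic is thus a sum of `R` independent squares, with mean `2n` and variance `σ² = R (8a² + 2a)`.
A central limit theorem, uniform in the number of bins and the intensity as long as `R` and `R a =
n` are both large (`tendsto_stdSumLaw`, `exists_forall_lt_stdSumLaw`), shows that level `α` forces
`t ≥ 2n + 0.9 z σ`, where `z` is the normal quantile.

The alternative is the bump on the cube of side `1/m` at the origin. If the bins are at least as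
wide as the cube (`M ≤ m`), one bin contains the whole cube, the positive and negative parts of the
bump cancel there, and the statistic has its null law: the power is at most `α ≤ 2 / z²`. If the
bins are narrower, at most a fraction `(2/m)^d` of them see the bump. Each of these gains at most
`a² / 4` in mean through the squared difference of intensities. For `m ^ d ≳ n ^ (2/3)` and `R ≥ m ^
d` the total gain is at most `0.01 σ`, and the variance grows by at most 4 percent
(`shift_and_variance_le`). Chebyshev's inequality at the forced threshold then bounds the power by
`2 / z²` (`exists_forall_rejectionProb_bumped_le`).

For the second claim the same pair is used with `1/m` of order `n ^ (-2/(3d))`. The indicator of the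
upper-right sub-cube, divided by a bound for its perimeter, shows that its distance `dBV` is at
least `1 / (8dm)` (`le_dBV_bumped`). -/

/-! ### Moments of the Poisson distribution -/

theorem integrable_exp_mul_poissonMeasure (r : ℝ≥0) (s : ℝ) :
    Integrable (fun k : ℕ => Real.exp (s * k)) (poissonMeasure r) := by
  rw [integrable_poissonMeasure_iff]
  have h := (NormedSpace.expSeries_div_summable (r * Real.exp s : ℝ)).mul_left (Real.exp (-r))
  refine h.congr fun k => ?_
  rw [Real.norm_eq_abs, Real.abs_exp, mul_pow, ← Real.exp_nat_mul, mul_comm s]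
  ring

theorem integral_exp_mul_poissonMeasure (r : ℝ≥0) (s : ℝ) :
    ∫ k : ℕ, Real.exp (s * k) ∂(poissonMeasure r) = Real.exp (r * (Real.exp s - 1)) := by
  rw [integral_poissonMeasure]
  have h := (NormedSpace.expSeries_div_hasSum_exp (r * Real.exp s : ℝ)).mul_left (Real.exp (-r))
  rw [← Real.exp_eq_exp_ℝ, ← Real.exp_add] at h
  rw [show (r : ℝ) * (Real.exp s - 1) = -r + r * Real.exp s by ring, ← h.tsum_eq]
  refine tsum_congr fun k => ?_
  rw [mul_pow, ← Real.exp_nat_mul, mul_comm s, smul_eq_mul]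
  ring

theorem integrable_pow_poissonMeasure (r : ℝ≥0) (p : ℕ) :
    Integrable (fun k : ℕ => (k : ℝ) ^ p) (poissonMeasure r) := by
  have h := (integrable_exp_mul_poissonMeasure r 1).const_mul (p.factorial : ℝ)
  refine h.mono' .of_discrete (Filter.Eventually.of_forall fun k => ?_)
  have := Real.pow_div_factorial_le_exp (k : ℝ) (Nat.cast_nonneg k) p
  rw [div_le_iff₀ (by positivity)] at this
  rw [Real.norm_of_nonneg (by positivity), one_mul, mul_comm]
  exact this

/-- Since `k / k! = 1 / (k-1)!`, weighting by `k` shifts the index. Repeated use computes the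
moments up to order four. -/
theorem integral_natCast_mul_poissonMeasure (r : ℝ≥0) (f : ℕ → ℝ)
    (hf : Integrable (fun k : ℕ => (k : ℝ) * f k) (poissonMeasure r)) :
    ∫ k : ℕ, (k : ℝ) * f k ∂(poissonMeasure r) = r * ∫ k : ℕ, f (k + 1) ∂(poissonMeasure r) := by
  rw [integral_poissonMeasure, integral_poissonMeasure, ← tsum_mul_left]
  have hs := (hasSum_integral_poissonMeasure hf).summable
  rw [hs.tsum_eq_zero_add]
  simp only [Nat.cast_zero, zero_mul, smul_zero, zero_add]
  refine tsum_congr fun k => ?_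
  simp only [smul_eq_mul, Nat.factorial_succ]
  push_cast
  field_simp
  ring

theorem integral_poly_poissonMeasure (r : ℝ≥0) :
    ∫ k : ℕ, (k : ℝ) ∂(poissonMeasure r) = r ∧
    ∫ k : ℕ, (k : ℝ) ^ 2 ∂(poissonMeasure r) = r ^ 2 + r ∧
    ∫ k : ℕ, (k : ℝ) ^ 3 ∂(poissonMeasure r) = r ^ 3 + 3 * r ^ 2 + r ∧
    ∫ k : ℕ, (k : ℝ) ^ 4 ∂(poissonMeasure r) = r ^ 4 + 6 * r ^ 3 + 7 * r ^ 2 + r := by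
  have hi := integrable_pow_poissonMeasure r
  have hi1 : Integrable (fun k : ℕ => (k : ℝ)) (poissonMeasure r) := by simpa using hi 1
  have h1 : ∫ k : ℕ, (k : ℝ) ∂(poissonMeasure r) = r := by
    have := integral_natCast_mul_poissonMeasure r (fun _ => 1) (by simpa using hi1)
    simpa using this
  have h2 : ∫ k : ℕ, (k : ℝ) ^ 2 ∂(poissonMeasure r) = r ^ 2 + r := by
    have := integral_natCast_mul_poissonMeasure r (fun k => k) (by simpa [← sq] using hi 2)
    simp only [← sq] at this
    rw [this]
    push_cast
    rw [integral_add hi1 (integrable_const _), h1]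
    simp
    ring
  have h3 : ∫ k : ℕ, (k : ℝ) ^ 3 ∂(poissonMeasure r) = r ^ 3 + 3 * r ^ 2 + r := by
    have := integral_natCast_mul_poissonMeasure r (fun k => (k : ℝ) ^ 2)
      (by simpa [← pow_succ'] using hi 3)
    simp only [← pow_succ'] at this
    rw [this]
    have e : ∀ k : ℕ, (((k + 1 : ℕ) : ℝ)) ^ 2 = (k : ℝ) ^ 2 + 2 * k + 1 := fun k => by
      push_cast; ring
    simp_rw [e]
    rw [integral_add ((hi 2).fun_add (hi1.const_mul _)) (integrable_const _),
      integral_add (hi 2) (hi1.const_mul _), integral_const_mul, h1, h2]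
    simp
    ring
  refine ⟨h1, h2, h3, ?_⟩
  have := integral_natCast_mul_poissonMeasure r (fun k => (k : ℝ) ^ 3)
    (by simpa [← pow_succ'] using hi 4)
  simp only [← pow_succ'] at this
  rw [this]
  have e : ∀ k : ℕ, (((k + 1 : ℕ) : ℝ)) ^ 3 = (k : ℝ) ^ 3 + 3 * (k : ℝ) ^ 2 + 3 * k + 1 :=
    fun k => by push_cast; ring
  simp_rw [e]
  rw [integral_add (((hi 3).fun_add ((hi 2).const_mul _)).fun_add (hi1.const_mul _)) (integrable_const _),
    integral_add ((hi 3).fun_add ((hi 2).const_mul _)) (hi1.const_mul _),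
    integral_add (hi 3) ((hi 2).const_mul _), integral_const_mul, integral_const_mul, h1, h2, h3]
  simp
  ring

/-! ### Moments of the Skellam distribution -/

/-- The Skellam distribution: the law of the difference of two independent Poisson variables. -/
noncomputable def skellam (a b : ℝ≥0) : Measure ℝ :=
  ((poissonMeasure a).prod (poissonMeasure b)).map fun p : ℕ × ℕ => (p.1 : ℝ) - p.2

instance isProbabilityMeasure_skellam (a b : ℝ≥0) : IsProbabilityMeasure (skellam a b) :=
  Measure.isProbabilityMeasure_map .of_discrete

theorem integrable_skellam_iff {a b : ℝ≥0} {E : Type*} [NormedAddCommGroup E] {f : ℝ → E}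
    (hf : StronglyMeasurable f) : Integrable f (skellam a b) ↔
      Integrable (fun p : ℕ × ℕ => f (p.1 - p.2)) ((poissonMeasure a).prod (poissonMeasure b)) :=
  integrable_map_measure hf.aestronglyMeasurable .of_discrete

theorem integral_skellam {a b : ℝ≥0} {E : Type*} [NormedAddCommGroup E] [NormedSpace ℝ E]
    {f : ℝ → E} (hf : StronglyMeasurable f) : ∫ x, f x ∂(skellam a b) =
      ∫ p : ℕ × ℕ, f (p.1 - p.2) ∂((poissonMeasure a).prod (poissonMeasure b)) :=
  integral_map .of_discrete hf.aestronglyMeasurable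

theorem integrable_exp_mul_skellam (a b : ℝ≥0) (s : ℝ) :
    Integrable (fun x => Real.exp (s * x)) (skellam a b) := by
  rw [integrable_skellam_iff (by fun_prop)]
  have := (integrable_exp_mul_poissonMeasure a s).mul_prod (integrable_exp_mul_poissonMeasure b (-s))
  refine this.congr (Filter.Eventually.of_forall fun p => ?_)
  simp only
  rw [← Real.exp_add]
  congr 1
  ring

theorem integral_exp_mul_skellam (a b : ℝ≥0) (s : ℝ) :
    ∫ x, Real.exp (s * x) ∂(skellam a b)
      = Real.exp (a * (Real.exp s - 1) + b * (Real.exp (-s) - 1)) := by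
  rw [integral_skellam (by fun_prop), Real.exp_add, ← integral_exp_mul_poissonMeasure,
    ← integral_exp_mul_poissonMeasure, ← integral_prod_mul]
  refine integral_congr_ae (Filter.Eventually.of_forall fun p => ?_)
  simp only
  rw [← Real.exp_add]
  congr 1
  ring

theorem abs_pow_le_factorial_mul_exp (p : ℕ) (x : ℝ) :
    |x| ^ p ≤ p.factorial * (Real.exp (1 * x) + Real.exp (-1 * x)) := by
  have h := Real.pow_div_factorial_le_exp |x| (abs_nonneg x) p
  rw [div_le_iff₀ (by positivity)] at h
  refine h.trans ?_
  rw [mul_comm]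
  gcongr
  rcases abs_cases x with ⟨h, _⟩ | ⟨h, _⟩ <;> rw [h]
  · simp [Real.exp_nonneg]
  · simp [Real.exp_nonneg]

theorem integrable_abs_pow_skellam (a b : ℝ≥0) (p : ℕ) :
    Integrable (fun x => |x| ^ p) (skellam a b) := by
  have h := ((integrable_exp_mul_skellam a b 1).add (integrable_exp_mul_skellam a b (-1))).const_mul
    (p.factorial : ℝ)
  refine h.mono' (by fun_prop) (Filter.Eventually.of_forall fun x => ?_)
  rw [Real.norm_of_nonneg (by positivity)]
  exact abs_pow_le_factorial_mul_exp p x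

theorem integrable_pow_skellam (a b : ℝ≥0) (p : ℕ) :
    Integrable (fun x => x ^ p) (skellam a b) :=
  (integrable_abs_pow_skellam a b p).mono' (by fun_prop)
    (Filter.Eventually.of_forall fun x => by simp)

theorem integral_sq_skellam (a b : ℝ≥0) :
    ∫ x, x ^ 2 ∂(skellam a b) = ((a : ℝ) - b) ^ 2 + (a + b) := by
  obtain ⟨a1, a2, -, -⟩ := integral_poly_poissonMeasure a
  obtain ⟨b1, b2, -, -⟩ := integral_poly_poissonMeasure b
  have ia := integrable_pow_poissonMeasure a
  have ib := integrable_pow_poissonMeasure b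
  have I : ∀ p q, Integrable (fun z : ℕ × ℕ => (z.1 : ℝ) ^ p * (z.2 : ℝ) ^ q)
      ((poissonMeasure a).prod (poissonMeasure b)) := fun p q => (ia p).mul_prod (ib q)
  have J : ∀ p q, ∫ z : ℕ × ℕ, (z.1 : ℝ) ^ p * (z.2 : ℝ) ^ q
      ∂((poissonMeasure a).prod (poissonMeasure b)) = (∫ k : ℕ, (k : ℝ) ^ p ∂(poissonMeasure a)) *
        ∫ k : ℕ, (k : ℝ) ^ q ∂(poissonMeasure b) := fun p q =>
    integral_prod_mul (fun k : ℕ => (k : ℝ) ^ p) fun k : ℕ => (k : ℝ) ^ q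
  rw [integral_skellam (by fun_prop)]
  have e : ∀ z : ℕ × ℕ, ((z.1 : ℝ) - z.2) ^ 2 = (z.1 : ℝ) ^ 2 * (z.2 : ℝ) ^ 0
      - 2 * ((z.1 : ℝ) ^ 1 * (z.2 : ℝ) ^ 1) + (z.1 : ℝ) ^ 0 * (z.2 : ℝ) ^ 2 := fun z => by ring
  simp_rw [e]
  rw [integral_add ((I 2 0).sub' ((I 1 1).const_mul _)) (I 0 2),
    integral_sub (I 2 0) ((I 1 1).const_mul _), integral_const_mul, J, J, J]
  simp only [pow_one, a1, a2, b1, b2, pow_zero, integral_const, probReal_univ, smul_eq_mul]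
  ring

theorem integral_pow_four_skellam (a b : ℝ≥0) :
    ∫ x, x ^ 4 ∂(skellam a b) = ((a : ℝ) - b) ^ 4 + 6 * (a - b) ^ 2 * (a + b)
      + 4 * (a - b) ^ 2 + 3 * (a + b) ^ 2 + (a + b) := by
  obtain ⟨a1, a2, a3, a4⟩ := integral_poly_poissonMeasure a
  obtain ⟨b1, b2, b3, b4⟩ := integral_poly_poissonMeasure b
  have ia := integrable_pow_poissonMeasure a
  have ib := integrable_pow_poissonMeasure b
  have I : ∀ p q, Integrable (fun z : ℕ × ℕ => (z.1 : ℝ) ^ p * (z.2 : ℝ) ^ q)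
      ((poissonMeasure a).prod (poissonMeasure b)) := fun p q => (ia p).mul_prod (ib q)
  have J : ∀ p q, ∫ z : ℕ × ℕ, (z.1 : ℝ) ^ p * (z.2 : ℝ) ^ q
      ∂((poissonMeasure a).prod (poissonMeasure b)) = (∫ k : ℕ, (k : ℝ) ^ p ∂(poissonMeasure a)) *
        ∫ k : ℕ, (k : ℝ) ^ q ∂(poissonMeasure b) := fun p q =>
    integral_prod_mul (fun k : ℕ => (k : ℝ) ^ p) fun k : ℕ => (k : ℝ) ^ q
  rw [integral_skellam (by fun_prop)]
  have e : ∀ z : ℕ × ℕ, ((z.1 : ℝ) - z.2) ^ 4 = (z.1 : ℝ) ^ 4 * (z.2 : ℝ) ^ 0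
      - 4 * ((z.1 : ℝ) ^ 3 * (z.2 : ℝ) ^ 1) + 6 * ((z.1 : ℝ) ^ 2 * (z.2 : ℝ) ^ 2)
      - 4 * ((z.1 : ℝ) ^ 1 * (z.2 : ℝ) ^ 3) + (z.1 : ℝ) ^ 0 * (z.2 : ℝ) ^ 4 := fun z => by ring
  simp_rw [e]
  rw [integral_add ((((I 4 0).sub' ((I 3 1).const_mul _)).fun_add ((I 2 2).const_mul _)).sub'
      ((I 1 3).const_mul _)) (I 0 4),
    integral_sub (((I 4 0).sub' ((I 3 1).const_mul _)).fun_add ((I 2 2).const_mul _))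
      ((I 1 3).const_mul _),
    integral_add ((I 4 0).sub' ((I 3 1).const_mul _)) ((I 2 2).const_mul _),
    integral_sub (I 4 0) ((I 3 1).const_mul _), integral_const_mul, integral_const_mul,
    integral_const_mul, J, J, J, J, J]
  simp only [pow_one, a1, a2, a3, a4, b1, b2, b3, b4, pow_zero, integral_const, probReal_univ,
    smul_eq_mul]
  ring

theorem memLp_sq_skellam (a b : ℝ≥0) : MemLp (fun x : ℝ => x ^ 2) 2 (skellam a b) := by
  rw [memLp_two_iff_integrable_sq (by fun_prop)]
  simpa only [← pow_mul] using integrable_pow_skellam a b 4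

theorem variance_sq_skellam (a b : ℝ≥0) :
    Var[fun x : ℝ => x ^ 2; skellam a b]
      = 4 * ((a : ℝ) - b) ^ 2 * (a + b) + 4 * (a - b) ^ 2 + 2 * (a + b) ^ 2 + (a + b) := by
  rw [variance_eq_sub (memLp_sq_skellam a b)]
  simp only [Pi.pow_apply, ← pow_mul]
  rw [integral_pow_four_skellam, integral_sq_skellam]
  ring

/-- The left side is a single term of the cosh series, times `6! = 720`; the other terms are
nonnegative. Sixth moments are thereby controlled by the moment generating function. -/
theorem pow_six_le_mul_cosh_sub_one (x : ℝ) : x ^ 6 ≤ 720 * (Real.cosh x - 1) := by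
  have h := Real.hasSum_cosh x
  have := sum_le_hasSum (Finset.range 4) (fun i _ => by
    rw [pow_mul]; positivity) h
  simp [Finset.sum_range_succ, Nat.factorial] at this
  nlinarith [sq_nonneg x, sq_nonneg (x ^ 2)]

/-- A bound of the sixth moment of the symmetric Skellam distribution, of the right order both for
small and for large intensities. -/
theorem integral_pow_six_skellam_le (a : ℝ≥0) :
    ∫ x, x ^ 6 ∂(skellam a a) ≤ 11520 * (a * (1 + a) ^ 2) := by
  -- The scale `s` is of the order of the inverse standard deviation when `a` is large and stays
  -- bounded when `a` is small. It keeps `a * s ^ 2 ≤ 1`, so the exponent of the moment generating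
  -- function is at most `2`; dividing `a * s ^ 2` by `s ^ 6` produces `a * (1 + a) ^ 2`.
  set s : ℝ := √(1 / (1 + a)) with hs
  have ha : (0 : ℝ) ≤ a := a.2
  have hs2 : s ^ 2 = 1 / (1 + a) := Real.sq_sqrt (by positivity)
  have hsp : 0 < s := Real.sqrt_pos.2 (by positivity)
  have hs1 : s ^ 2 ≤ 1 := by
    rw [hs2, div_le_one (by positivity)]; linarith
  have has : a * s ^ 2 ≤ 1 := by
    rw [hs2, mul_one_div, div_le_one (by positivity)]; linarith
  have hcosh : Real.cosh s - 1 ≤ s ^ 2 := by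
    have h1 := Real.cosh_le_exp_half_sq s
    have h2 := Real.abs_exp_sub_one_le (x := s ^ 2 / 2) (by
      rw [abs_of_nonneg (by positivity)]; linarith)
    rw [abs_of_nonneg (a := s ^ 2 / 2) (by positivity)] at h2
    linarith [le_abs_self (Real.exp (s ^ 2 / 2) - 1)]
  have hcosh0 := Real.one_le_cosh s
  have hint : Integrable (fun x => Real.cosh (s * x)) (skellam a a) := by
    have := ((integrable_exp_mul_skellam a a s).add (integrable_exp_mul_skellam a a (-s))).div_const 2
    refine this.congr (Filter.Eventually.of_forall fun x => ?_)
    simp [Real.cosh_eq]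
  have hE : ∫ x, Real.cosh (s * x) ∂(skellam a a) = Real.exp (2 * a * (Real.cosh s - 1)) := by
    have e : ∀ x, Real.cosh (s * x) = (Real.exp (s * x) + Real.exp (-s * x)) / 2 := fun x => by
      rw [Real.cosh_eq, neg_mul]
    simp_rw [e]
    rw [integral_div, integral_add (integrable_exp_mul_skellam a a s)
      (integrable_exp_mul_skellam a a (-s)), integral_exp_mul_skellam, integral_exp_mul_skellam,
      neg_neg, Real.cosh_eq]
    rw [add_comm ((a : ℝ) * (Real.exp (-s) - 1)), add_self_div_two]
    congr 1
    ring
  have hle : ∫ x, (s * x) ^ 6 ∂(skellam a a) ≤ 720 * (Real.exp (2 * a * (Real.cosh s - 1)) - 1) := by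
    have h1 : ∫ x, 720 * (Real.cosh (s * x) - 1) ∂(skellam a a)
        = 720 * (Real.exp (2 * a * (Real.cosh s - 1)) - 1) := by
      rw [integral_const_mul, integral_sub hint (integrable_const _), hE]
      simp
    rw [← h1]
    refine integral_mono ?_ ((hint.sub (integrable_const _)).const_mul _) fun x =>
      pow_six_le_mul_cosh_sub_one _
    simp_rw [mul_pow]
    exact (integrable_pow_skellam a a 6).const_mul _
  -- With `y = 2 a s² ≤ 2`, use `exp y - 1 ≤ y * exp y` and `exp 2 ≤ 8`. Keeping the factor `a`
  -- matters for small intensities.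
  have hexp : Real.exp (2 * a * (Real.cosh s - 1)) - 1 ≤ 16 * (a * s ^ 2) := by
    have h1 : 2 * a * (Real.cosh s - 1) ≤ 2 * (a * s ^ 2) := by nlinarith
    have h2 := Real.exp_le_exp.2 h1
    set y := 2 * (a * s ^ 2) with hy
    have hy2 : y ≤ 2 := by linarith
    have hy0 : 0 ≤ y := by positivity
    have h3 : Real.exp y ≤ 8 := by
      refine (Real.exp_le_exp.2 hy2).trans ?_
      rw [show (2 : ℝ) = 1 + 1 by norm_num, Real.exp_add]
      nlinarith [Real.exp_one_lt_d9, Real.exp_pos 1]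
    have h4 : 1 - y ≤ Real.exp (-y) := by linarith [Real.add_one_le_exp (-y)]
    have h5 : Real.exp y * Real.exp (-y) = 1 := by rw [← Real.exp_add]; simp
    nlinarith [Real.exp_pos y]
  simp_rw [mul_pow] at hle
  rw [integral_const_mul] at hle
  have h6 : s ^ 6 * ∫ x, x ^ 6 ∂(skellam a a) ≤ s ^ 6 * (11520 * (a * (1 + a) ^ 2)) := by
    refine hle.trans ?_
    have e : s ^ 6 * (11520 * (a * (1 + a) ^ 2)) = 11520 * (a * s ^ 2) := by
      rw [show s ^ 6 = s ^ 2 * (s ^ 2) ^ 2 by ring, hs2]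
      field_simp
    linarith
  exact le_of_mul_le_mul_left h6 (by positivity)

/-- Convexity gives `(x² + 2a)³ ≤ 4 (x⁶ + 8a³)`, and `a (1 + a)² ≤ 2 (a + a³)` absorbs the middle
term of the sixth moment bound. -/
theorem integral_abs_sq_sub_pow_three_skellam_le (a : ℝ≥0) :
    ∫ x, |x ^ 2 - 2 * a| ^ 3 ∂(skellam a a) ≤ 100000 * ((a : ℝ) + (a : ℝ) ^ 3) := by
  have ha : (0 : ℝ) ≤ a := a.2
  have h : ∀ x : ℝ, |x ^ 2 - 2 * a| ^ 3 ≤ 4 * x ^ 6 + 32 * (a : ℝ) ^ 3 := fun x => by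
    have h1 : |x ^ 2 - 2 * a| ≤ x ^ 2 + 2 * a := by
      rw [abs_le]; constructor <;> nlinarith [sq_nonneg x]
    have h2 : |x ^ 2 - 2 * a| ^ 3 ≤ (x ^ 2 + 2 * a) ^ 3 := by gcongr
    refine h2.trans ?_
    have : 0 ≤ (x ^ 2 + 2 * a) * (x ^ 2 - 2 * a) ^ 2 := by positivity
    nlinarith
  have hi := ((integrable_pow_skellam a a 6).const_mul 4).add
    (integrable_const (32 * (a : ℝ) ^ 3))
  have h1 : ∫ x, |x ^ 2 - 2 * a| ^ 3 ∂(skellam a a)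
      ≤ ∫ x, (4 * x ^ 6 + 32 * (a : ℝ) ^ 3) ∂(skellam a a) :=
    integral_mono_of_nonneg (Filter.Eventually.of_forall fun x => by positivity) hi
      (Filter.Eventually.of_forall h)
  refine h1.trans ?_
  rw [integral_add ((integrable_pow_skellam a a 6).const_mul 4) (integrable_const _),
    integral_const_mul, integral_const]
  have := integral_pow_six_skellam_le a
  simp only [probReal_univ, smul_eq_mul, one_mul]
  nlinarith [mul_nonneg ha (sq_nonneg ((a : ℝ) - 1)), pow_nonneg ha 3]

/-! ### Poisson splitting and the joint law of the bin differences -/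

theorem integral_cexp_mul_poissonMeasure (r : ℝ≥0) (t : ℝ) :
    ∫ k : ℕ, Complex.exp (t * k * Complex.I) ∂(poissonMeasure r)
      = Complex.exp (r * (Complex.exp (t * Complex.I) - 1)) := by
  rw [← charFun_map_cast_poissonMeasure, charFun_apply_real,
    integral_map .of_discrete (by fun_prop)]
  simp

theorem integral_pow_complex_poissonMeasure (r : ℝ≥0) (z : ℂ) :
    ∫ k : ℕ, z ^ k ∂(poissonMeasure r) = Complex.exp (r * (z - 1)) := by
  rw [integral_poissonMeasure]
  have h := (NormedSpace.expSeries_div_hasSum_exp (r * z : ℂ)).mul_left (Complex.exp (-r))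
  rw [← Complex.exp_eq_exp_ℂ, ← Complex.exp_add] at h
  rw [show (r : ℂ) * (z - 1) = -r + r * z by ring, ← h.tsum_eq]
  refine tsum_congr fun k => ?_
  rw [mul_pow, Complex.real_smul]
  push_cast
  ring

theorem charFun_skellam (a b : ℝ≥0) (t : ℝ) : charFun (skellam a b) t
    = Complex.exp (a * (Complex.exp (t * Complex.I) - 1))
      * Complex.exp (b * (Complex.exp (-(t * Complex.I)) - 1)) := by
  have hb := integral_cexp_mul_poissonMeasure b (-t)
  rw [charFun_apply_real, integral_skellam (Measurable.stronglyMeasurable (by fun_prop)),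
    ← integral_cexp_mul_poissonMeasure]
  rw [show -((t : ℂ) * Complex.I) = ((-t : ℝ) : ℂ) * Complex.I by push_cast; ring, ← hb,
    ← integral_prod_mul]
  refine integral_congr_ae (Filter.Eventually.of_forall fun p => ?_)
  simp only
  rw [← Complex.exp_add]
  congr 1
  push_cast
  ring

theorem integral_prod_range_infinitePi {S : Type*} [MeasurableSpace S] (P : Measure S)
    [IsProbabilityMeasure P] (h : S → ℂ) (hh : Measurable h) (n : ℕ) :
    ∫ x : ℕ → S, ∏ i ∈ Finset.range n, h (x i) ∂(Measure.infinitePi fun _ : ℕ => P)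
      = (∫ s, h s ∂P) ^ n := by
  have e := Measure.infinitePi_map_restrict (μ := fun _ : ℕ => P) (I := Finset.range n)
  have h1 : ∀ x : ℕ → S, ∏ i ∈ Finset.range n, h (x i)
      = ∏ i : Finset.range n, h ((Finset.range n).restrict x i) := fun x => by
    rw [← Finset.prod_coe_sort]
    rfl
  simp_rw [h1]
  have h2 := integral_map (μ := Measure.infinitePi fun _ : ℕ => P) (φ := (Finset.range n).restrict)
    (f := fun y : (Finset.range n → S) => ∏ i, h (y i))
    (Measurable.aemeasurable (Finset.measurable_restrict _))
    (Measurable.aestronglyMeasurable (by fun_prop))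
  rw [← h2, e, integral_fintype_prod_eq_prod (f := fun _ => h)]
  simp

/-- A point lies in at most one of the disjoint sets, so at most one term of the sum is nonzero and
the exponential is affine in the indicators. -/
theorem cexp_sum_indicator {S ι : Type*} [Fintype ι] (A : ι → Set S)
    (hA : Pairwise (Function.onFun Disjoint A)) (t : ι → ℝ) (x : S) :
    Complex.exp (((∑ j, t j * (A j).indicator (fun _ => (1 : ℝ)) x : ℝ) : ℂ) * Complex.I)
      = 1 + ∑ j, (A j).indicator (fun _ => (1 : ℂ)) x
          * (Complex.exp (t j * Complex.I) - 1) := by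
  by_cases hx : ∃ j, x ∈ A j
  · obtain ⟨j, hj⟩ := hx
    have hne : ∀ k, k ≠ j → x ∉ A k := fun k hk hxk =>
      (Set.disjoint_left.1 (hA hk) hxk hj).elim
    rw [Finset.sum_eq_single j (fun k _ hk => by simp [hne k hk]) (by simp),
      Finset.sum_eq_single j (fun k _ hk => by simp [hne k hk]) (by simp)]
    simp [hj]
  · push Not at hx
    simp [hx]

theorem integral_cexp_sum_indicator {S ι : Type*} [MeasurableSpace S] [Fintype ι]
    (P : ProbabilityMeasure S) (A : ι → Set S) (hm : ∀ j, MeasurableSet (A j))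
    (hA : Pairwise (Function.onFun Disjoint A)) (t : ι → ℝ) :
    ∫ x, Complex.exp (((∑ j, t j * (A j).indicator (fun _ => (1 : ℝ)) x : ℝ) : ℂ) * Complex.I)
        ∂(P : Measure S)
      = 1 + ∑ j, (P (A j) : ℂ) * (Complex.exp (t j * Complex.I) - 1) := by
  simp_rw [cexp_sum_indicator A hA]
  have hi : ∀ j, Integrable (fun x => (A j).indicator (fun _ => (1 : ℂ)) x
      * (Complex.exp (t j * Complex.I) - 1)) (P : Measure S) := fun j =>
    ((integrable_const _).indicator (hm j)).mul_const _
  rw [integral_add (integrable_const _) (integrable_finsetSum _ fun j _ => hi j),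
    integral_finsetSum _ fun j _ => hi j]
  congr 1
  · simp
  · refine Finset.sum_congr rfl fun j _ => ?_
    rw [integral_mul_const, integral_indicator_const _ (hm j)]
    simp [measureReal_def]
    exact Or.inl rfl

/-- For a fixed sample size `k` the inner integral is `z ^ k`, with `z - 1` a sum over the bins.
Averaging over a Poisson `k` gives `exp (n (z - 1))`, which turns that sum into a product: this is
the independence of the counts. -/
theorem integral_cexp_sum_count {ι : Type*} [Fintype ι] {d : ℕ} (n : ℝ≥0)
    (P : ProbabilityMeasure (Fin d → ℝ)) (A : ι → Set (Fin d → ℝ))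
    (hm : ∀ j, MeasurableSet (A j)) (hA : Pairwise (Function.onFun Disjoint A)) (t : ι → ℝ) :
    ∫ k, ∫ x, Complex.exp (((∑ j, t j * count k x (A j) : ℝ) : ℂ) * Complex.I)
        ∂(Measure.infinitePi fun _ : ℕ => (P : Measure (Fin d → ℝ))) ∂(poissonMeasure n)
      = ∏ j, Complex.exp ((n * P (A j) : ℝ≥0) * (Complex.exp (t j * Complex.I) - 1)) := by
  have h : ∀ (k : ℕ) (x : ℕ → Fin d → ℝ),
      Complex.exp (((∑ j, t j * count k x (A j) : ℝ) : ℂ) * Complex.I)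
      = ∏ i ∈ Finset.range k, Complex.exp
        (((∑ j, t j * (A j).indicator (fun _ => (1 : ℝ)) (x i) : ℝ) : ℂ) * Complex.I) := by
    intro k x
    rw [← Complex.exp_sum, ← Finset.sum_mul, ← Complex.ofReal_sum]
    simp_rw [count, Finset.mul_sum]
    rw [Finset.sum_comm]
  have hmeas : Measurable fun y : Fin d → ℝ => Complex.exp
        (((∑ j, t j * (A j).indicator (fun _ => (1 : ℝ)) y : ℝ) : ℂ) * Complex.I) := by
    have : ∀ j, Measurable ((A j).indicator fun _ : Fin d → ℝ => (1 : ℝ)) := fun j =>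
      measurable_const.indicator (hm j)
    fun_prop
  simp_rw [h]
  simp_rw [integral_prod_range_infinitePi _ _ hmeas]
  rw [integral_pow_complex_poissonMeasure, integral_cexp_sum_indicator P A hm hA,
    ← Complex.exp_sum]
  congr 1
  rw [add_sub_cancel_left, Finset.mul_sum]
  refine Finset.sum_congr rfl fun j _ => ?_
  push_cast
  ring

/-- The vector of differences of bin counts. -/
noncomputable def countDiff {ι : Type*} {d : ℕ} (A : ι → Set (Fin d → ℝ))
    (ω : (ℕ × ℕ) × ((ℕ → Fin d → ℝ) × (ℕ → Fin d → ℝ))) (j : ι) : ℝ :=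
  count ω.1.1 ω.2.1 (A j) - count ω.1.2 ω.2.2 (A j)

theorem measurable_countDiff {ι : Type*} {d : ℕ} {A : ι → Set (Fin d → ℝ)}
    (hm : ∀ j, MeasurableSet (A j)) : Measurable (countDiff A) := by
  refine measurable_pi_lambda _ fun j => ?_
  have h1 := (measurable_count (hm j)).comp
    (f := fun ω : (ℕ × ℕ) × ((ℕ → Fin d → ℝ) × (ℕ → Fin d → ℝ)) => (ω.1.1, ω.2.1)) (by fun_prop)
  have h2 := (measurable_count (hm j)).comp
    (f := fun ω : (ℕ × ℕ) × ((ℕ → Fin d → ℝ) × (ℕ → Fin d → ℝ)) => (ω.1.2, ω.2.2)) (by fun_prop)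
  exact h1.sub h2

instance isProbabilityMeasure_poissonModel {d : ℕ} (n : ℝ≥0)
    (P Q : ProbabilityMeasure (Fin d → ℝ)) : IsProbabilityMeasure (poissonModel n P Q) := by
  unfold poissonModel
  infer_instance

theorem integral_mul_poissonModel {d : ℕ} (n : ℝ≥0) (P Q : ProbabilityMeasure (Fin d → ℝ))
    (F G : ℕ → (ℕ → Fin d → ℝ) → ℂ) (hF : Measurable (Function.uncurry F))
    (hG : Measurable (Function.uncurry G)) (hF1 : ∀ k x, ‖F k x‖ ≤ 1)
    (hG1 : ∀ k x, ‖G k x‖ ≤ 1) :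
    ∫ ω, F ω.1.1 ω.2.1 * G ω.1.2 ω.2.2 ∂(poissonModel n P Q)
      = (∫ k, ∫ x, F k x ∂(Measure.infinitePi fun _ : ℕ => (P : Measure (Fin d → ℝ)))
          ∂(poissonMeasure n))
        * ∫ k, ∫ x, G k x ∂(Measure.infinitePi fun _ : ℕ => (Q : Measure (Fin d → ℝ)))
          ∂(poissonMeasure n) := by
  have hm : Measurable fun ω : (ℕ × ℕ) × ((ℕ → Fin d → ℝ) × (ℕ → Fin d → ℝ)) =>
      F ω.1.1 ω.2.1 * G ω.1.2 ω.2.2 := by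
    have h1 := hF.comp (f := fun ω : (ℕ × ℕ) × ((ℕ → Fin d → ℝ) × (ℕ → Fin d → ℝ)) =>
      (ω.1.1, ω.2.1)) (by fun_prop)
    have h2 := hG.comp (f := fun ω : (ℕ × ℕ) × ((ℕ → Fin d → ℝ) × (ℕ → Fin d → ℝ)) =>
      (ω.1.2, ω.2.2)) (by fun_prop)
    exact h1.mul h2
  have hi : Integrable (fun ω : (ℕ × ℕ) × ((ℕ → Fin d → ℝ) × (ℕ → Fin d → ℝ)) =>
      F ω.1.1 ω.2.1 * G ω.1.2 ω.2.2) (poissonModel n P Q) := by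
    refine Integrable.of_bound hm.aestronglyMeasurable 1 (Filter.Eventually.of_forall fun ω => ?_)
    rw [norm_mul]
    exact mul_le_one₀ (hF1 _ _) (norm_nonneg _) (hG1 _ _)
  unfold poissonModel at hi ⊢
  rw [integral_prod _ hi, ← integral_prod_mul]
  refine integral_congr_ae (Filter.Eventually.of_forall fun k => ?_)
  exact integral_prod_mul (F k.1) (G k.2)

/-- Poisson splitting: in the Poisson model, the differences of the counts in disjoint bins are
independent Skellam variables. -/
theorem map_countDiff_poissonModel {ι : Type*} [Fintype ι] {d : ℕ} (n : ℝ≥0)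
    (P Q : ProbabilityMeasure (Fin d → ℝ)) (A : ι → Set (Fin d → ℝ))
    (hm : ∀ j, MeasurableSet (A j)) (hA : Pairwise (Function.onFun Disjoint A)) :
    (poissonModel n P Q).map (countDiff A)
      = Measure.pi fun j => skellam (n * P (A j)) (n * Q (A j)) := by
  have hmeas := measurable_countDiff hm
  have := Measure.isProbabilityMeasure_map (μ := poissonModel n P Q) hmeas.aemeasurable
  -- A law on the product is the product law exactly when its characteristic function factors, so
  -- only this factorization has to be checked.
  rw [← charFun_eq_pi_iff]
  intro t
  rw [charFun_apply, ← MeasurableEquiv.coe_toLp, integral_map_equiv,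
    integral_map hmeas.aemeasurable (Measurable.aestronglyMeasurable (by fun_prop))]
  have h : ∀ ω, Complex.exp
      ((inner ℝ ((MeasurableEquiv.toLp 2 (ι → ℝ)) (countDiff A ω)) t : ℝ) * Complex.I)
      = Complex.exp (((∑ j, t j * count ω.1.1 ω.2.1 (A j) : ℝ) : ℂ) * Complex.I)
        * Complex.exp (((∑ j, (-t j) * count ω.1.2 ω.2.2 (A j) : ℝ) : ℂ) * Complex.I) := by
    intro ω
    rw [← Complex.exp_add, ← add_mul, ← Complex.ofReal_add, ← Finset.sum_add_distrib,
      MeasurableEquiv.coe_toLp, PiLp.inner_apply]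
    congr 4 with j
    simp [countDiff]
    ring
  simp_rw [h]
  have hmc : ∀ s : ι → ℝ, Measurable (Function.uncurry fun (k : ℕ) (x : ℕ → Fin d → ℝ) =>
      Complex.exp (((∑ j, s j * count k x (A j) : ℝ) : ℂ) * Complex.I)) := fun s => by
    have : ∀ j, Measurable fun p : ℕ × (ℕ → Fin d → ℝ) => count p.1 p.2 (A j) := fun j =>
      measurable_count (hm j)
    simp only [Function.uncurry_def]
    fun_prop
  rw [integral_mul_poissonModel n P Q
    (fun k x => Complex.exp (((∑ j, t j * count k x (A j) : ℝ) : ℂ) * Complex.I))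
    (fun k x => Complex.exp (((∑ j, (-t j) * count k x (A j) : ℝ) : ℂ) * Complex.I))
    (hmc _) (hmc _) (fun k x => (Complex.norm_exp_ofReal_mul_I _).le)
    (fun k x => (Complex.norm_exp_ofReal_mul_I _).le),
    integral_cexp_sum_count n P A hm hA, integral_cexp_sum_count n Q A hm hA,
    ← Finset.prod_mul_distrib]
  refine Finset.prod_congr rfl fun j _ => ?_
  rw [charFun_skellam]
  simp

theorem measurableSet_cell {d : ℕ} (M : ℕ) (j : Fin d → Fin M) : MeasurableSet (cell M j) :=
  MeasurableSet.univ_pi fun _ => measurableSet_Ioc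

theorem mem_cell_iff_ceil {d M : ℕ} (hM : 0 < M) (j : Fin d → Fin M) (x : Fin d → ℝ) :
    x ∈ cell M j ↔ ∀ i, ⌈x i * M⌉ = (j i : ℤ) + 1 := by
  have hM' : (0 : ℝ) < M := by exact_mod_cast hM
  simp only [cell, Set.mem_univ_pi, Set.mem_Ioc, Int.ceil_eq_iff]
  refine forall_congr' fun i => ?_
  rw [div_lt_iff₀ hM', le_div_iff₀ hM']
  push_cast
  rw [add_sub_cancel_right]

theorem pairwise_disjoint_cell {d M : ℕ} (hM : 0 < M) :
    Pairwise (Function.onFun Disjoint (cell M : (Fin d → Fin M) → Set (Fin d → ℝ))) := by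
  intro j k hjk
  refine Set.disjoint_left.2 fun x hj hk => hjk ?_
  rw [mem_cell_iff_ceil hM] at hj hk
  ext i
  have := (hj i).symm.trans (hk i)
  omega

theorem rejectionProb_eq_pi {d : ℕ} (n : ℝ≥0) (P Q : ProbabilityMeasure (Fin d → ℝ)) {M : ℕ}
    (hM : 0 < M) (t : ℝ) : rejectionProb n P Q M t
      = (Measure.pi fun j : Fin d → Fin M => skellam (n * P (cell M j)) (n * Q (cell M j))).real
          {y | t < ∑ j, y j ^ 2} := by
  rw [rejectionProb_eq, ← map_countDiff_poissonModel n P Q (cell M) (measurableSet_cell M)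
    (pairwise_disjoint_cell hM), map_measureReal_apply
      (measurable_countDiff (measurableSet_cell M))
      (measurableSet_lt measurable_const (by fun_prop))]
  rfl

/-! ### A uniform central limit theorem for sums of squared Skellam variables -/

/-- For `|x| ≤ 1` this is the Taylor remainder; for `|x| > 1` each term is dominated by `|x| ^ 3`.
No restriction on `x` remains, so the bound can be integrated. -/
theorem norm_cexp_mul_I_sub_le (x : ℝ) :
    ‖Complex.exp (x * Complex.I) - (1 + x * Complex.I - x ^ 2 / 2)‖ ≤ 4 * |x| ^ 3 := by
  have hn : ‖(x : ℂ) * Complex.I‖ = |x| := by simp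
  by_cases hx : |x| ≤ 1
  · have h := Complex.exp_bound (x := x * Complex.I) (by rwa [hn]) (n := 3) (by norm_num)
    have e : ∑ m ∈ Finset.range 3, ((x : ℂ) * Complex.I) ^ m / (m.factorial : ℂ)
        = 1 + x * Complex.I - x ^ 2 / 2 := by
      simp [Finset.sum_range_succ, mul_pow]
      ring
    rw [e, hn] at h
    refine h.trans ?_
    norm_num [Nat.factorial]
    nlinarith [pow_nonneg (abs_nonneg x) 3]
  · push Not at hx
    have h1 : ‖Complex.exp (x * Complex.I)‖ = 1 := Complex.norm_exp_ofReal_mul_I x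
    have h2 : ‖(x : ℂ) ^ 2 / 2‖ = |x| ^ 2 / 2 := by simp
    have h3 : ‖(1 : ℂ)‖ = 1 := norm_one
    have h4 := norm_sub_le (Complex.exp (x * Complex.I)) (1 + x * Complex.I - x ^ 2 / 2)
    have h5 := norm_sub_le (1 + (x : ℂ) * Complex.I) (x ^ 2 / 2)
    have h6 := norm_add_le (1 : ℂ) ((x : ℂ) * Complex.I)
    have h7 : |x| ≤ |x| ^ 3 := le_self_pow₀ hx.le (by norm_num)
    have h8 : |x| ^ 2 ≤ |x| ^ 3 := pow_le_pow_right₀ hx.le (by norm_num)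
    linarith

theorem norm_integral_cexp_sub_le {S : Type*} [MeasurableSpace S] (ν : Measure S)
    [IsProbabilityMeasure ν] (g : S → ℝ) (hg : Measurable g)
    (h3 : Integrable (fun x => |g x| ^ 3) ν) (h2 : Integrable (fun x => g x ^ 2) ν)
    (h1 : Integrable g ν) (h0 : ∫ x, g x ∂ν = 0) :
    ‖∫ x, Complex.exp (g x * Complex.I) ∂ν - (1 - ((∫ x, g x ^ 2 ∂ν : ℝ) : ℂ) / 2)‖
      ≤ 4 * ∫ x, |g x| ^ 3 ∂ν := by
  have i0 : Integrable (fun x => Complex.exp (g x * Complex.I)) ν :=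
    Integrable.of_bound (Measurable.aestronglyMeasurable (by fun_prop)) 1
      (Filter.Eventually.of_forall fun x => (Complex.norm_exp_ofReal_mul_I _).le)
  have i1 : Integrable (fun x => (g x : ℂ) * Complex.I) ν := h1.ofReal.mul_const _
  have i2 : Integrable (fun x => (g x : ℂ) ^ 2 / 2) ν := by
    have := h2.ofReal (𝕜 := ℂ)
    simp only [Complex.coe_algebraMap, Complex.ofReal_pow] at this
    exact this.div_const 2
  have e1 : ∫ x, (g x : ℂ) * Complex.I ∂ν = 0 := by
    rw [integral_mul_const, integral_complex_ofReal, h0]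
    simp
  have e2 : ∫ x, (g x : ℂ) ^ 2 / 2 ∂ν = ((∫ x, g x ^ 2 ∂ν : ℝ) : ℂ) / 2 := by
    rw [integral_div, ← integral_complex_ofReal]
    simp
  have e : ∫ x, (Complex.exp (g x * Complex.I) - (1 + g x * Complex.I - g x ^ 2 / 2)) ∂ν
      = ∫ x, Complex.exp (g x * Complex.I) ∂ν - (1 - ((∫ x, g x ^ 2 ∂ν : ℝ) : ℂ) / 2) := by
    rw [integral_sub i0 (((integrable_const _).fun_add i1).sub' i2),
      integral_sub ((integrable_const _).fun_add i1) i2, integral_add (integrable_const _) i1,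
      e1, e2]
    simp
  rw [← e, ← integral_const_mul]
  exact norm_integral_le_of_norm_le (h3.const_mul 4)
    (Filter.Eventually.of_forall fun x => norm_cexp_mul_I_sub_le (g x))

theorem norm_pow_sub_pow_le_of_norm_le_one (a b : ℂ) (ha : ‖a‖ ≤ 1) (hb : ‖b‖ ≤ 1) (n : ℕ) :
    ‖a ^ n - b ^ n‖ ≤ n * ‖a - b‖ := by
  induction n with
  | zero => simp
  | succ k ih =>
    have e : a ^ (k + 1) - b ^ (k + 1) = a ^ k * (a - b) + (a ^ k - b ^ k) * b := by ring
    rw [e]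
    refine (norm_add_le _ _).trans ?_
    rw [norm_mul, norm_mul, norm_pow]
    have h1 : ‖a‖ ^ k * ‖a - b‖ ≤ 1 * ‖a - b‖ := by
      gcongr
      exact pow_le_one₀ (norm_nonneg _) ha
    have h2 : ‖a ^ k - b ^ k‖ * ‖b‖ ≤ ‖a ^ k - b ^ k‖ * 1 := by gcongr
    push_cast
    linarith

/-- The standard deviation of the sum of squares of `R` symmetric Skellam variables. -/
noncomputable def nullSD (R : ℕ) (a : ℝ) : ℝ := √(R * (8 * a ^ 2 + 2 * a))

/-- The law of the standardized sum of squares of symmetric Skellam variables. -/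
noncomputable def stdSumLaw (ι : Type*) [Fintype ι] (a : ℝ≥0) : Measure ℝ :=
  (Measure.pi fun _ : ι => skellam a a).map fun y =>
    ∑ j, (y j ^ 2 - 2 * a) / nullSD (Fintype.card ι) a

instance isProbabilityMeasure_stdSumLaw (ι : Type*) [Fintype ι] (a : ℝ≥0) :
    IsProbabilityMeasure (stdSumLaw ι a) :=
  Measure.isProbabilityMeasure_map (Measurable.aemeasurable (by fun_prop))

theorem charFun_stdSumLaw (ι : Type*) [Fintype ι] (a : ℝ≥0) (u : ℝ) :
    charFun (stdSumLaw ι a) u = (∫ x, Complex.exp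
      ((u * ((x ^ 2 - 2 * a) / nullSD (Fintype.card ι) a) : ℝ) * Complex.I) ∂(skellam a a))
        ^ Fintype.card ι := by
  rw [stdSumLaw, charFun_apply_real, integral_map (Measurable.aemeasurable (by fun_prop))
    (Measurable.aestronglyMeasurable (by fun_prop))]
  have h : ∀ y : ι → ℝ, Complex.exp (u *
      ((∑ j, (y j ^ 2 - 2 * a) / nullSD (Fintype.card ι) a : ℝ) : ℂ) * Complex.I)
      = ∏ j, Complex.exp
        ((u * ((y j ^ 2 - 2 * a) / nullSD (Fintype.card ι) a) : ℝ) * Complex.I) := fun y => by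
    rw [← Complex.exp_sum, ← Finset.sum_mul, ← Complex.ofReal_mul, Finset.mul_sum,
      Complex.ofReal_sum]
  simp_rw [h]
  rw [integral_fintype_prod_eq_prod (f := fun (_ : ι) (x : ℝ) => Complex.exp
        ((u * ((x ^ 2 - 2 * a) / nullSD (Fintype.card ι) a) : ℝ) * Complex.I))]
  simp

/-- This is the Lyapunov ratio. The part `a` of the third moment is compared with the summand `2a`
of the variance and the part `a ^ 3` with `8a ^ 2`, so that small and large intensities are covered
at once. -/
theorem card_mul_moment_le {R a : ℝ} (hR : 0 < R) (ha : 0 < a) :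
    R * (a + a ^ 3) / √(R * (8 * a ^ 2 + 2 * a)) ^ 3 ≤ 1 / √(R * a) + 1 / √R := by
  set s := √(R * (8 * a ^ 2 + 2 * a)) with hs
  have hs2 : s ^ 2 = R * (8 * a ^ 2 + 2 * a) := Real.sq_sqrt (by positivity)
  have hsp : 0 < s := Real.sqrt_pos.2 (by positivity)
  have h1 : √(R * a) ≤ s := Real.sqrt_le_sqrt (by nlinarith [mul_pos hR ha, mul_pos hR (pow_pos ha 2)])
  have h2 : √R * a ≤ s := by
    rw [← Real.sqrt_sq ha.le, ← Real.sqrt_mul hR.le]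
    exact Real.sqrt_le_sqrt (by nlinarith [mul_pos hR ha, mul_pos hR (pow_pos ha 2)])
  have hRa : 0 < √(R * a) := Real.sqrt_pos.2 (by positivity)
  have hRp : 0 < √R := Real.sqrt_pos.2 hR
  have e : R * (a + a ^ 3) / s ^ 3 = R * a / s ^ 3 + R * a ^ 3 / s ^ 3 := by ring
  rw [e]
  gcongr ?_ + ?_
  · rw [div_le_div_iff₀ (by positivity) hRa, one_mul]
    calc R * a * √(R * a) ≤ s ^ 2 * s := by
          gcongr
          rw [hs2]; nlinarith [mul_pos hR ha, mul_pos hR (pow_pos ha 2)]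
      _ = s ^ 3 := by ring
  · rw [div_le_div_iff₀ (by positivity) hRp, one_mul]
    calc R * a ^ 3 * √R = (R * a ^ 2) * (√R * a) := by ring
      _ ≤ s ^ 2 * s := by
          gcongr
          rw [hs2]; nlinarith [mul_pos hR ha, mul_pos hR (pow_pos ha 2)]
      _ = s ^ 3 := by ring

/-- Both characteristic functions are `R`-th powers of numbers in the unit disc, the Gaussian one of
`exp (-u² / (2R))`, so their distance is at most `R` times that of the bases. The bases agree to
second order: the third moment gives the first error term, and the quadratic remainder of `exp`, for
which `hu` keeps the argument in the unit disc, gives the second. -/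
theorem norm_charFun_stdSumLaw_sub_le (ι : Type*) [Fintype ι] [Nonempty ι] (a : ℝ≥0) (ha : 0 < a)
    (u : ℝ) (hu : u ^ 2 ≤ 2 * Fintype.card ι) :
    ‖charFun (stdSumLaw ι a) u - charFun (gaussianReal 0 1) u‖
      ≤ 400000 * |u| ^ 3 * (1 / √(Fintype.card ι * a) + 1 / √(Fintype.card ι))
        + u ^ 4 / (4 * Fintype.card ι) := by
  set R := Fintype.card ι with hRdef
  have hR : (0 : ℝ) < R := by exact_mod_cast Fintype.card_pos
  have ha' : (0 : ℝ) < a := ha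
  set σ := nullSD R a with hσ
  have hσ2 : σ ^ 2 = R * (8 * a ^ 2 + 2 * a) := Real.sq_sqrt (by positivity)
  have hσp : 0 < σ := Real.sqrt_pos.2 (by positivity)
  set g : ℝ → ℝ := fun x => u * ((x ^ 2 - 2 * a) / σ) with hgdef
  have hgm : Measurable g := by fun_prop
  have hi2 := integrable_pow_skellam a a 2
  have hi4 := integrable_pow_skellam a a 4
  have hi6 := integrable_pow_skellam a a 6
  have i1 : Integrable g (skellam a a) :=
    ((hi2.sub' (integrable_const _)).div_const _).const_mul _
  have e2 : ∀ x, g x ^ 2 = u ^ 2 / σ ^ 2 * (x ^ 4 - 4 * a * x ^ 2 + 4 * a ^ 2) := fun x => by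
    simp only [hgdef]; ring
  have i2 : Integrable (fun x => g x ^ 2) (skellam a a) := by
    simp_rw [e2]
    exact ((hi4.sub' (hi2.const_mul _)).fun_add (integrable_const _)).const_mul _
  have e3 : ∀ x, |g x| ^ 3 = |u| ^ 3 / σ ^ 3 * |x ^ 2 - 2 * a| ^ 3 := fun x => by
    simp only [hgdef, abs_mul, abs_div, abs_of_pos hσp]; ring
  have i3' : Integrable (fun x => |x ^ 2 - 2 * (a : ℝ)| ^ 3) (skellam a a) := by
    refine ((hi6.const_mul 4).fun_add (integrable_const (32 * (a : ℝ) ^ 3))).mono'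
      (Measurable.aestronglyMeasurable (by fun_prop)) (Filter.Eventually.of_forall fun x => ?_)
    rw [Real.norm_of_nonneg (by positivity)]
    have h1 : |x ^ 2 - 2 * (a : ℝ)| ≤ x ^ 2 + 2 * a := by
      rw [abs_le]; constructor <;> nlinarith [sq_nonneg x]
    have h2 : |x ^ 2 - 2 * (a : ℝ)| ^ 3 ≤ (x ^ 2 + 2 * a) ^ 3 := by gcongr
    refine h2.trans ?_
    have : 0 ≤ (x ^ 2 + 2 * (a : ℝ)) * (x ^ 2 - 2 * a) ^ 2 := by positivity
    nlinarith
  have i3 : Integrable (fun x => |g x| ^ 3) (skellam a a) := by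
    simp_rw [e3]
    exact i3'.const_mul _
  have m1 : ∫ x, g x ∂(skellam a a) = 0 := by
    simp only [hgdef]
    rw [integral_const_mul, integral_div, integral_sub hi2 (integrable_const _),
      integral_sq_skellam]
    simp
    ring_nf
    simp
  have m2 : ∫ x, g x ^ 2 ∂(skellam a a) = u ^ 2 / R := by
    simp_rw [e2]
    rw [integral_const_mul, integral_add (hi4.sub' (hi2.const_mul _)) (integrable_const _),
      integral_sub hi4 (hi2.const_mul _), integral_const_mul, integral_sq_skellam,
      integral_pow_four_skellam, hσ2]
    simp
    field_simp
    ring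
  have hb := norm_integral_cexp_sub_le (skellam a a) g hgm i3 i2 i1 m1
  rw [m2] at hb
  have m3 : ∫ x, |g x| ^ 3 ∂(skellam a a) ≤ |u| ^ 3 / σ ^ 3 * (100000 * (a + (a : ℝ) ^ 3)) := by
    simp_rw [e3]
    rw [integral_const_mul]
    gcongr
    exact integral_abs_sq_sub_pow_three_skellam_le a
  set φ := ∫ x, Complex.exp (g x * Complex.I) ∂(skellam a a) with hφ
  have hφ1 : ‖φ‖ ≤ 1 := by
    have := norm_integral_le_of_norm_le_const (μ := skellam a a)
      (f := fun x => Complex.exp (g x * Complex.I)) (C := 1)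
      (Filter.Eventually.of_forall fun x => (Complex.norm_exp_ofReal_mul_I _).le)
    simpa using this
  set z : ℂ := ((-(u ^ 2 / (2 * R)) : ℝ) : ℂ) with hz
  have hz1 : ‖z‖ = u ^ 2 / (2 * R) := by
    rw [hz, Complex.norm_real, norm_neg, Real.norm_of_nonneg (by positivity)]
  have hexp1 : ‖Complex.exp z‖ ≤ 1 := by
    rw [hz, ← Complex.ofReal_exp, Complex.norm_real, Real.norm_of_nonneg (Real.exp_nonneg _),
      Real.exp_le_one_iff]
    exact neg_nonpos.2 (by positivity)
  have hgauss : charFun (gaussianReal 0 1) u = Complex.exp z ^ R := by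
    rw [charFun_gaussianReal, ← Complex.exp_nat_mul, hz]
    congr 1
    have : (R : ℂ) ≠ 0 := by exact_mod_cast hR.ne'
    push_cast
    field_simp
    ring
  have hexp2 := Complex.norm_exp_sub_one_sub_id_le (x := z) (by
    rw [hz1, div_le_one (by positivity)]; exact hu)
  rw [charFun_stdSumLaw, hgauss]
  refine (norm_pow_sub_pow_le_of_norm_le_one φ _ hφ1 hexp1 R).trans ?_
  have htri : ‖φ - Complex.exp z‖ ≤ 4 * (|u| ^ 3 / σ ^ 3 * (100000 * (a + (a : ℝ) ^ 3)))
      + (u ^ 2 / (2 * R)) ^ 2 := by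
    have e : φ - Complex.exp z = (φ - (1 - ((u ^ 2 / R : ℝ) : ℂ) / 2))
        - (Complex.exp z - 1 - z) := by
      rw [hz]; push_cast; ring
    rw [e]
    refine (norm_sub_le _ _).trans ?_
    rw [hz1] at hexp2
    linarith
  have hmom := card_mul_moment_le hR ha'
  have hσe : √((R : ℝ) * (8 * (a : ℝ) ^ 2 + 2 * a)) = σ := rfl
  rw [hσe] at hmom
  calc (R : ℝ) * ‖φ - Complex.exp z‖
      ≤ R * (4 * (|u| ^ 3 / σ ^ 3 * (100000 * (a + (a : ℝ) ^ 3))) + (u ^ 2 / (2 * R)) ^ 2) := by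
        gcongr
    _ = 400000 * |u| ^ 3 * (R * (a + (a : ℝ) ^ 3) / σ ^ 3) + u ^ 4 / (4 * R) := by
        field_simp
        ring
    _ ≤ _ := by gcongr

open Filter Topology in
/-- A central limit theorem for the sum of squares of independent symmetric Skellam variables,
uniform in the number of variables and in their intensity. -/
theorem tendsto_stdSumLaw {ι : ℕ → Type} [∀ k, Fintype (ι k)] [∀ k, Nonempty (ι k)]
    (a : ℕ → ℝ≥0) (ha : ∀ k, 0 < a k)
    (h1 : Tendsto (fun k => (Fintype.card (ι k) : ℝ)) atTop atTop)
    (h2 : Tendsto (fun k => (Fintype.card (ι k) : ℝ) * a k) atTop atTop) :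
    Tendsto (fun k => (⟨stdSumLaw (ι k) (a k), inferInstance⟩ : ProbabilityMeasure ℝ)) atTop
      (nhds (X := ProbabilityMeasure ℝ) ⟨gaussianReal 0 1, inferInstance⟩) := by
  refine ProbabilityMeasure.tendsto_of_tendsto_charFun fun u => ?_
  rw [tendsto_iff_norm_sub_tendsto_zero]
  have hlim : Tendsto (fun k => 400000 * |u| ^ 3 * (1 / √(Fintype.card (ι k) * a k)
      + 1 / √(Fintype.card (ι k))) + u ^ 4 / (4 * Fintype.card (ι k))) atTop (𝓝 0) := by
    have t1 := (Real.tendsto_sqrt_atTop.comp h2).const_div_atTop 1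
    have t2 := (Real.tendsto_sqrt_atTop.comp h1).const_div_atTop 1
    have t3 := (h1.const_mul_atTop (by norm_num : (0 : ℝ) < 4)).const_div_atTop (u ^ 4)
    simpa using ((t1.add t2).const_mul (400000 * |u| ^ 3)).add t3
  refine squeeze_zero' (Eventually.of_forall fun k => norm_nonneg _) ?_ hlim
  filter_upwards [h1.eventually_ge_atTop (u ^ 2)] with k hk
  exact norm_charFun_stdSumLaw_sub_le (ι k) (a k) (ha k) u (by
    have := sq_nonneg u
    linarith)

open Filter Topology in
-- If no `N` worked, counterexamples for `N = 0, 1, 2, …` would form a sequence to which the central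
-- limit theorem applies. The portmanteau inequality for the open half-line then contradicts the
-- strict inequality `hα`.
theorem exists_forall_lt_stdSumLaw (x α : ℝ) (hα : α < (gaussianReal 0 1).real (Set.Ioi x)) :
    ∃ N : ℝ, ∀ (ι : Type) [Fintype ι] [Nonempty ι] (a : ℝ≥0), 0 < a →
      N ≤ Fintype.card ι → N ≤ Fintype.card ι * a →
        α < (stdSumLaw ι a).real (Set.Ioi x) := by
  by_contra! h
  choose ι hF hN a ha h1 h2 h3 using fun k : ℕ => h k
  have ht := tendsto_stdSumLaw (ι := ι) a ha
    (tendsto_atTop_mono h1 tendsto_natCast_atTop_atTop)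
    (tendsto_atTop_mono h2 tendsto_natCast_atTop_atTop)
  have hl := ProbabilityMeasure.le_liminf_measure_open_of_tendsto ht (isOpen_Ioi (a := x))
  have hb : ∀ k, ((⟨stdSumLaw (ι k) (a k), inferInstance⟩ : ProbabilityMeasure ℝ) : Measure ℝ)
      (Set.Ioi x) ≤ ENNReal.ofReal α := fun k => by
    rw [← ofReal_measureReal]
    exact ENNReal.ofReal_le_ofReal (h3 k)
  have hl2 : (gaussianReal 0 1) (Set.Ioi x) ≤ ENNReal.ofReal α := by
    refine hl.trans ?_
    refine (liminf_le_liminf (Eventually.of_forall hb)).trans ?_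
    simp
  have hα0 : 0 ≤ α := measureReal_nonneg.trans (h3 0)
  have := ENNReal.toReal_mono ENNReal.ofReal_ne_top hl2
  rw [ENNReal.toReal_ofReal hα0] at this
  exact absurd hα (not_lt.2 this)

/-! ### Bin probabilities under the localized alternative -/

theorem unif_cell {d M : ℕ} (hM : 0 < M) (j : Fin d → Fin M) :
    (unif d (cell M j) : ℝ) = 1 / (M : ℝ) ^ d := by
  have hM' : (0 : ℝ) < M := by exact_mod_cast hM
  have h : unifMeasure d (cell M j) = ∏ _i : Fin d, ENNReal.ofReal (1 / M) := by
    rw [cell, unif_box]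
    · refine Finset.prod_congr rfl fun i _ => ?_
      congr 1
      ring
    · intro i; positivity
    · intro i
      rw [div_le_one hM']
      exact_mod_cast (j i).2
  have e : (unif d (cell M j) : ℝ) = (unifMeasure d (cell M j)).toReal := rfl
  rw [e, h]
  simp

theorem bumpMeasure_real_apply {d m : ℕ} (j : Fin d → Fin m) {A : Set (Fin d → ℝ)}
    (hA : MeasurableSet A) : (bumpMeasure m j).real A
      = (unifMeasure d).real A + 1 / 2 * ((unifMeasure d).real (A ∩ cellL m j)
        - (unifMeasure d).real (A ∩ cellR m j)) := by
  have hL := (integrable_const (μ := (unifMeasure d).restrict A) (1 : ℝ)).indicator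
    (measurableSet_cellL m j)
  have hR := (integrable_const (μ := (unifMeasure d).restrict A) (1 : ℝ)).indicator
    (measurableSet_cellR m j)
  have hb : Integrable (bump m j) ((unifMeasure d).restrict A) := hL.sub hR
  have hnn : ∀ x, 0 ≤ 1 + 1 / 2 * bump m j x := fun x => by
    have := bump_ge m j x
    linarith
  have hi : Integrable (fun x => 1 + 1 / 2 * bump m j x) ((unifMeasure d).restrict A) :=
    (integrable_const _).add (hb.const_mul _)
  rw [measureReal_def, bumpMeasure, withDensity_apply _ hA,
    ← ofReal_integral_eq_lintegral_ofReal hi (Filter.Eventually.of_forall hnn),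
    ENNReal.toReal_ofReal (integral_nonneg hnn), integral_add (integrable_const _) (hb.const_mul _),
    integral_const_mul]
  unfold bump
  rw [integral_sub hL hR, integral_indicator_const _ (measurableSet_cellL m j),
    integral_indicator_const _ (measurableSet_cellR m j),
    measureReal_restrict_apply (measurableSet_cellL m j),
    measureReal_restrict_apply (measurableSet_cellR m j), Set.inter_comm A, Set.inter_comm A]
  simp

theorem cellL_subset {d m : ℕ} (j : Fin d → Fin m) : cellL m j ⊆ cell m j := by
  refine Set.pi_mono fun i _ => Set.Ioc_subset_Ioc_right ?_
  gcongr
  norm_num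

theorem cellR_subset {d m : ℕ} (j : Fin d → Fin m) : cellR m j ⊆ cell m j := by
  refine Set.pi_mono fun i _ => Set.Ioc_subset_Ioc_left ?_
  gcongr
  norm_num

theorem disjoint_cellL_cellR {d m : ℕ} (hd : 1 ≤ d) (j : Fin d → Fin m) :
    Disjoint (cellL m j) (cellR m j) := by
  refine Set.disjoint_left.2 fun x hL hR => ?_
  have h1 := (hL ⟨0, hd⟩ (Set.mem_univ _)).2
  have h2 := (hR ⟨0, hd⟩ (Set.mem_univ _)).1
  exact absurd h2 (not_lt.2 h1)

/-- The cube at the origin. -/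
def originCell (d : ℕ) {m : ℕ} (hm : 0 < m) : Fin d → Fin m := fun _ => ⟨0, hm⟩

theorem disjoint_cell_originCell {d m M : ℕ} (hm : 0 < m) (hM : 0 < M) (j : Fin d → Fin M)
    (h : ¬ ∀ i, (j i : ℕ) * m < M) : Disjoint (cell M j) (cell m (originCell d hm)) := by
  push Not at h
  obtain ⟨i, hi⟩ := h
  have hm' : (0 : ℝ) < m := by exact_mod_cast hm
  have hM' : (0 : ℝ) < M := by exact_mod_cast hM
  refine Set.disjoint_left.2 fun x h1 h2 => ?_
  have h3 := (h1 i (Set.mem_univ _)).1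
  have h4 := (h2 i (Set.mem_univ _)).2
  simp only [originCell, Nat.cast_zero, zero_add] at h4
  have h5 : (1 : ℝ) / m ≤ (j i : ℝ) / M := by
    rw [div_le_div_iff₀ hm' hM', one_mul]
    exact_mod_cast hi
  linarith

theorem bumped_cell_of_disjoint {d m M : ℕ} (j : Fin d → Fin m) (k : Fin d → Fin M)
    (h : Disjoint (cell M k) (cell m j)) : bumped m j (cell M k) = unif d (cell M k) := by
  have e := bumpMeasure_real_apply j (measurableSet_cell M k)
  rw [(h.mono_right (cellL_subset j)).inter_eq, (h.mono_right (cellR_subset j)).inter_eq] at e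
  have e' : (bumpMeasure m j).real (cell M k) = (unifMeasure d).real (cell M k) := by
    simpa using e
  exact NNReal.coe_injective e'

/-- The two halves of the bump have equal mass and cancel inside a bin that contains both. -/
theorem bumped_cell_of_subset {d m M : ℕ} (j : Fin d → Fin m) (k : Fin d → Fin M)
    (h : cell m j ⊆ cell M k) : bumped m j (cell M k) = unif d (cell M k) := by
  have e := bumpMeasure_real_apply j (measurableSet_cell M k)
  rw [Set.inter_eq_right.2 ((cellL_subset j).trans h),
    Set.inter_eq_right.2 ((cellR_subset j).trans h), measureReal_def (s := cellL m j),
    unif_cellL_eq_cellR, ← measureReal_def] at e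
  have e' : (bumpMeasure m j).real (cell M k) = (unifMeasure d).real (cell M k) := by
    simpa using e
  exact NNReal.coe_injective e'

theorem abs_bumped_cell_sub_le {d m M : ℕ} (j : Fin d → Fin m) (k : Fin d → Fin M) :
    |(unif d (cell M k) : ℝ) - bumped m j (cell M k)| ≤ (unif d (cell M k) : ℝ) / 2 := by
  have e := bumpMeasure_real_apply j (measurableSet_cell M k)
  have e1 : (unif d (cell M k) : ℝ) = (unifMeasure d).real (cell M k) := rfl
  have e2 : (bumped m j (cell M k) : ℝ) = (bumpMeasure m j).real (cell M k) := rfl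
  have h1 : (unifMeasure d).real (cell M k ∩ cellL m j) ≤ (unifMeasure d).real (cell M k) :=
    measureReal_mono Set.inter_subset_left
  have h2 : (unifMeasure d).real (cell M k ∩ cellR m j) ≤ (unifMeasure d).real (cell M k) :=
    measureReal_mono Set.inter_subset_left
  have h3 : 0 ≤ (unifMeasure d).real (cell M k ∩ cellL m j) := measureReal_nonneg
  have h4 : 0 ≤ (unifMeasure d).real (cell M k ∩ cellR m j) := measureReal_nonneg
  rw [e1, e2, e, abs_le]
  constructor <;> linarith

/-- This is the reason for placing the bump at the origin: there a cube no wider than the bins lies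
in a single bin even if `M` does not divide `m`. -/
theorem bumped_originCell_eq_of_le {d m M : ℕ} (hm : 0 < m) (hM : 0 < M) (hMm : M ≤ m)
    (k : Fin d → Fin M) :
    bumped m (originCell d hm) (cell M k) = unif d (cell M k) := by
  by_cases h : ∀ i, (k i : ℕ) * m < M
  · refine bumped_cell_of_subset _ _ (Set.pi_mono fun i _ => ?_)
    have hk : (k i : ℕ) = 0 := by
      by_contra h0
      have := h i
      have h1 : 1 * m ≤ (k i : ℕ) * m := Nat.mul_le_mul_right _ (Nat.one_le_iff_ne_zero.2 h0)
      omega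
    have hM' : (0 : ℝ) < M := by exact_mod_cast hM
    have hMm' : (M : ℝ) ≤ m := by exact_mod_cast hMm
    simp only [originCell, hk, Nat.cast_zero, zero_add, zero_div]
    exact Set.Ioc_subset_Ioc_right (one_div_le_one_div_of_le hM' hMm')
  · exact bumped_cell_of_disjoint _ _ (disjoint_cell_originCell hm hM k h)

theorem rejectionProb_bumped_eq_of_le {d m M : ℕ} (hm : 0 < m) (hM : 0 < M) (hMm : M ≤ m)
    (n : ℝ≥0) (t : ℝ) : rejectionProb n (unif d) (bumped m (originCell d hm)) M t
      = rejectionProb n (unif d) (unif d) M t := by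
  rw [rejectionProb_eq_pi n _ _ hM, rejectionProb_eq_pi n _ _ hM]
  simp_rw [bumped_originCell_eq_of_le hm hM hMm]

/-- The bins of side `1/M` that meet the cube of side `1/m` at the origin. -/
def affectedBins (d m M : ℕ) : Finset (Fin d → Fin M) :=
  Fintype.piFinset fun _ => Finset.univ.filter fun k : Fin M => (k : ℕ) * m < M

/-- In each coordinate at most `M / m + 1` indices qualify, which is at most `2M / m` because `m ≤
M`. -/
theorem card_affectedBins_le {d m M : ℕ} (hm : 0 < m) (hmM : m ≤ M) :
    ((affectedBins d m M).card : ℝ) ≤ 2 ^ d / (m : ℝ) ^ d * (M : ℝ) ^ d := by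
  have hm' : (0 : ℝ) < m := by exact_mod_cast hm
  have h1 : (Finset.univ.filter fun k : Fin M => (k : ℕ) * m < M).card ≤ M / m + 1 := by
    rw [← Finset.card_range (M / m + 1)]
    refine Finset.card_le_card_of_injOn (fun k => (k : ℕ)) (fun k hk => ?_)
      (fun a _ b _ h => Fin.ext h)
    simp only [Finset.coe_filter, Finset.mem_univ, true_and, Set.mem_ofPred_eq] at hk
    simp only [Finset.coe_range, Set.mem_Iio]
    exact Nat.lt_succ_of_le ((Nat.le_div_iff_mul_le hm).2 hk.le)
  have h2 : ((Finset.univ.filter fun k : Fin M => (k : ℕ) * m < M).card : ℝ) ≤ 2 / m * M := by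
    have h3 : ((M / m + 1 : ℕ) : ℝ) ≤ 2 / m * M := by
      push_cast
      have h4 : ((M / m : ℕ) : ℝ) ≤ M / m := Nat.cast_div_le
      have h5 : (1 : ℝ) ≤ M / m := by
        rw [one_le_div hm']
        exact_mod_cast hmM
      have h6 : (2 : ℝ) / m * M = M / m + M / m := by ring
      linarith
    exact le_trans (by exact_mod_cast h1) h3
  rw [affectedBins, Fintype.card_piFinset, Finset.prod_const, Finset.card_univ, Fintype.card_fin,
    ← div_pow, ← mul_pow]
  push_cast
  gcongr

theorem bumped_originCell_eq_of_notMem {d m M : ℕ} (hm : 0 < m) (hM : 0 < M) (k : Fin d → Fin M)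
    (hk : k ∉ affectedBins d m M) :
    bumped m (originCell d hm) (cell M k) = unif d (cell M k) :=
  bumped_cell_of_disjoint _ _ (disjoint_cell_originCell hm hM k (by
    simpa [affectedBins] using hk))

theorem sum_bumped_cell_le {d m M : ℕ} (hM : 0 < M) (j : Fin d → Fin m) :
    ∑ k : Fin d → Fin M, (bumped m j (cell M k) : ℝ) ≤ 1 := by
  have e : ∀ k : Fin d → Fin M, (bumped m j (cell M k) : ℝ) = (bumpMeasure m j).real (cell M k) :=
    fun _ => rfl
  simp_rw [e]
  rw [← measureReal_biUnion_finset (fun a _ b _ hab => pairwise_disjoint_cell hM hab)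
    fun k _ => measurableSet_cell M k]
  exact measureReal_le_one

/-! ### Regularity of the alternative and its separation in the total variation IPM -/

/-- On the cube both densities, hence all their mixtures, lie in `[1/2, 3/2]`, an interval contained
in `[1/B, B]` once `B ≥ 2`. -/
theorem mem_regularClass {d m : ℕ} (j : Fin d → Fin m) {B : ℝ} (hB : 2 ≤ B) :
    (unif d, bumped m j) ∈ regularClass d B := by
  have hcube : MeasurableSet (unitCube d) := MeasurableSet.univ_pi fun _ => measurableSet_Ioo
  have hbm : Measurable (bump m j) :=
    (measurable_const.indicator (measurableSet_cellL m j)).sub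
      (measurable_const.indicator (measurableSet_cellR m j))
  have hb1 : ∀ x, bump m j x ≤ 1 := fun x => by
    have h1 : (cellL m j).indicator (fun _ => (1 : ℝ)) x ≤ 1 :=
      Set.indicator_le_self' (fun _ _ => zero_le_one) x
    have h2 : 0 ≤ (cellR m j).indicator (fun _ => (1 : ℝ)) x :=
      Set.indicator_nonneg (fun _ _ => zero_le_one) x
    unfold bump
    linarith
  have hb2 := bump_ge m j
  have h0 : unifMeasure d (unitCube d)ᶜ = 0 := by
    rw [unifMeasure, Measure.restrict_apply hcube.compl]
    simp
  have hd1 : Measurable fun x => ENNReal.ofReal (1 + 1 / 2 * bump m j x) := by fun_prop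
  refine ⟨h0, withDensity_absolutelyContinuous _ _ h0, (unitCube d).indicator fun _ => 1,
    (unitCube d).indicator fun x => 1 + 1 / 2 * bump m j x, measurable_const.indicator hcube,
    Measurable.indicator (by fun_prop) hcube, Set.indicator_nonneg fun _ _ => zero_le_one,
    Set.indicator_nonneg fun x _ => by linarith [hb2 x], ?_, ?_, ?_⟩
  · have e : (fun x => ENNReal.ofReal ((unitCube d).indicator (fun _ => (1 : ℝ)) x))
        = (unitCube d).indicator fun _ => 1 := by
      ext x
      by_cases hx : x ∈ unitCube d <;> simp [hx]
    rw [e, withDensity_indicator hcube]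
    simp [unif, unifMeasure]
  · have e : (fun x => ENNReal.ofReal ((unitCube d).indicator
        (fun x => 1 + 1 / 2 * bump m j x) x))
        = (unitCube d).indicator fun x => ENNReal.ofReal (1 + 1 / 2 * bump m j x) := by
      ext x
      by_cases hx : x ∈ unitCube d <;> simp [hx]
    rw [e, withDensity_indicator hcube]
    rfl
  · intro x hx
    simp only [Set.indicator_of_mem hx]
    have h1 := hb1 x
    have h2 := hb2 x
    have hBinv : 1 / B ≤ 1 / 2 := one_div_le_one_div_of_le (by norm_num) hB
    refine ⟨by rw [abs_le]; constructor <;> linarith, fun w hw => ?_⟩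
    have hw1 := hw.1
    have hw2 := hw.2
    constructor <;> nlinarith

/-- By the divergence theorem the integral is the flux through `2 (k + 1)` faces of area `h ^ k`,
and each component of the field is at most `1` in absolute value. -/
theorem abs_integral_divergence_box_le {k : ℕ} (a : Fin (k + 1) → ℝ) {h : ℝ} (hh : 0 ≤ h)
    {φ : (Fin (k + 1) → ℝ) → Fin (k + 1) → ℝ} (hφ : φ ∈ testFields (k + 1)) :
    |∫ x in Set.Icc a (fun i => a i + h), divergence φ x| ≤ 2 * (k + 1) * h ^ k := by
  obtain ⟨hc, -, hb⟩ := hφ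
  have hle : a ≤ fun i => a i + h := fun i => by simpa using hh
  have hdiff : Differentiable ℝ φ := hc.differentiable (by norm_num)
  have hcont : Continuous fun x => ∑ i, fderiv ℝ φ x (Pi.single i 1) i := by
    have h1 : Continuous (fderiv ℝ φ) := hc.continuous_fderiv (by norm_num)
    refine continuous_finsetSum _ fun i _ => ?_
    exact (continuous_apply i).comp (h1.clm_apply continuous_const)
  have hdiv := integral_divergence_of_hasFDerivAt_off_countable a (fun i => a i + h) hle φ
    (fderiv ℝ φ) ∅ Set.countable_empty hc.continuous.continuousOn
    (fun x _ => (hdiff x).hasFDerivAt) (hcont.continuousOn.integrableOn_compact isCompact_Icc)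
  have hcomp : ∀ x i, ‖φ x i‖ ≤ 1 := fun x i => by
    have h1 : φ x i ^ 2 ≤ 1 :=
      (Finset.single_le_sum (f := fun i => φ x i ^ 2) (fun i _ => sq_nonneg _)
        (Finset.mem_univ i)).trans (hb x)
    rw [Real.norm_eq_abs]
    exact abs_le_one_iff_mul_self_le_one.2 (by nlinarith)
  have hface : ∀ (i : Fin (k + 1)) (c : ℝ),
      ‖∫ x in Set.Icc (a ∘ i.succAbove) ((fun i => a i + h) ∘ i.succAbove),
        φ (i.insertNth c x) i‖ ≤ h ^ k := fun i c => by
    have h1 := norm_setIntegral_le_of_norm_le_const (μ := volume)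
      (s := Set.Icc (a ∘ i.succAbove) ((fun i => a i + h) ∘ i.succAbove))
      (f := fun x => φ (i.insertNth c x) i) (C := 1) isCompact_Icc.measure_lt_top
      (fun x _ => hcomp _ i)
    have h2 : (volume : Measure (Fin k → ℝ)).real
        (Set.Icc (a ∘ i.succAbove) ((fun i => a i + h) ∘ i.succAbove)) = h ^ k := by
      rw [measureReal_def, Real.volume_Icc_pi_toReal (fun l => by simpa using hh)]
      simp
    rwa [h2, one_mul] at h1
  have e : ∫ x in Set.Icc a (fun i => a i + h), divergence φ x
      = ∫ x in Set.Icc a (fun i => a i + h), ∑ i, fderiv ℝ φ x (Pi.single i 1) i := rfl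
  rw [e, hdiv, ← Real.norm_eq_abs]
  refine (norm_sum_le _ _).trans ?_
  have h3 : ∀ i ∈ (Finset.univ : Finset (Fin (k + 1))),
      ‖(∫ x in Set.Icc (a ∘ i.succAbove) ((fun i => a i + h) ∘ i.succAbove),
        φ (i.insertNth (a i + h) x) i) -
      ∫ x in Set.Icc (a ∘ i.succAbove) ((fun i => a i + h) ∘ i.succAbove),
        φ (i.insertNth (a i) x) i‖ ≤ 2 * h ^ k := fun i _ => by
    refine (norm_sub_le _ _).trans ?_
    have := hface i (a i + h)
    have := hface i (a i)
    linarith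
  refine (Finset.sum_le_card_nsmul _ _ _ h3).trans (le_of_eq ?_)
  simp
  ring

theorem unifMeasure_real_cellR {d m : ℕ} (j : Fin d → Fin m) :
    (unifMeasure d).real (cellR m j) = (1 / (2 * m : ℝ)) ^ d := by
  have hN : ∀ i, (0 : ℝ) < m := fun i => by exact_mod_cast (Nat.zero_le _).trans_lt (j i).2
  have h : unifMeasure d (cellR m j) = ∏ _i : Fin d, ENNReal.ofReal (1 / (2 * m)) := by
    rw [cellR, unif_box]
    · refine Finset.prod_congr rfl fun i _ => ?_
      have := hN i
      congr 1
      field_simp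
      ring
    · intro i
      have := hN i
      positivity
    · intro i
      rw [div_le_one (hN i)]
      exact_mod_cast (j i).2
  rw [measureReal_def, h]
  simp

/-- The witness is the indicator of the upper-right sub-cube, of side `h = 1 / (2m)`, divided by `2
d h ^ (d-1)`. The uniform law gives this sub-cube mass `h ^ d` and the bumped law half of that, so
the gap is `h / (4d)`. -/
theorem le_dBV_bumped {d m : ℕ} (hd : 1 ≤ d) (hm : 0 < m) (j : Fin d → Fin m) :
    ((1 / (8 * d * m) : ℝ) : EReal) ≤ dBV (unif d) (bumped m j) := by
  obtain ⟨k, rfl⟩ : ∃ k, d = k + 1 := ⟨d - 1, by omega⟩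
  have hm' : (0 : ℝ) < m := by exact_mod_cast hm
  set h : ℝ := 1 / (2 * m) with hh
  have hp : 0 < h := by positivity
  set s : ℝ := 1 / (2 * (k + 1) * h ^ k) with hs
  have hsp : 0 < s := by positivity
  set f : (Fin (k + 1) → ℝ) → ℝ := (cellR m j).indicator fun _ => s with hf
  have hRm := measurableSet_cellR m j
  have hvol : volume (cellR m j) ≠ ∞ := by
    rw [cellR, Real.volume_pi_Ioc]
    exact ENNReal.prod_ne_top fun i _ => ENNReal.ofReal_ne_top
  have hfi : Integrable f := (integrable_indicator_iff hRm).2 (integrableOn_const hvol)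
  have hfP : Integrable f (unif (k + 1) : Measure (Fin (k + 1) → ℝ)) :=
    (integrable_const s).indicator hRm
  have hfQ : Integrable f (bumped m j : Measure (Fin (k + 1) → ℝ)) :=
    (integrable_const s).indicator hRm
  have hTV : totalVariation f ≤ 1 := by
    refine iSup₂_le fun φ hφ => ?_
    have e1 : ∀ x, f x * divergence φ x = (cellR m j).indicator (fun x => s * divergence φ x) x :=
      fun x => by
        by_cases hx : x ∈ cellR m j <;> simp [hf, hx]
    set a : Fin (k + 1) → ℝ := fun i => ((j i : ℝ) + 1 / 2) / m with ha
    have e2 : cellR m j = Set.univ.pi fun i => Set.Ioc (a i) (a i + h) := by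
      unfold cellR
      congr 1
      ext i : 1
      congr 1
      simp only [ha, hh]
      field_simp
      ring
    have e3 : ∫ x, f x * divergence φ x
        = s * ∫ x in Set.Icc a (fun i => a i + h), divergence φ x := by
      simp_rw [e1]
      rw [integral_indicator hRm, integral_const_mul, e2, volume_pi,
        setIntegral_congr_set Measure.univ_pi_Ioc_ae_eq_Icc]
    have h4 := abs_integral_divergence_box_le a hp.le hφ
    have h5 : s * ∫ x in Set.Icc a (fun i => a i + h), divergence φ x ≤ 1 := by
      calc s * ∫ x in Set.Icc a (fun i => a i + h), divergence φ x
          ≤ s * (2 * (k + 1) * h ^ k) := by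
            gcongr
            exact (le_abs_self _).trans h4
        _ = 1 := by
            rw [hs]
            field_simp
    rw [e3]
    exact_mod_cast h5
  refine le_iSup₂_of_le f ⟨hfi, hTV, hfP, hfQ⟩ ?_
  have eP : ∫ x, f x ∂(unif (k + 1) : Measure (Fin (k + 1) → ℝ)) = h ^ (k + 1) * s := by
    rw [hf, integral_indicator_const _ hRm, smul_eq_mul]
    congr 1
    exact unifMeasure_real_cellR j
  have eQ : ∫ x, f x ∂(bumped m j : Measure (Fin (k + 1) → ℝ)) = h ^ (k + 1) / 2 * s := by
    rw [hf, integral_indicator_const _ hRm, smul_eq_mul]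
    congr 1
    have h1 := bumpMeasure_real_apply j hRm
    rw [Set.inter_self, (disjoint_cellL_cellR hd j).symm.inter_eq, unifMeasure_real_cellR j] at h1
    refine h1.trans ?_
    simp only [measureReal_empty, hh]
    ring
  rw [eP, eQ]
  refine le_of_eq ?_
  congr 1
  rw [hs, pow_succ]
  have : h ^ k ≠ 0 := by positivity
  push_cast
  field_simp
  rw [hh]
  field_simp
  norm_num

/-! ### The normal quantile -/

theorem cdf_gaussianReal_zero : cdf (gaussianReal 0 1) 0 = 1 / 2 := by
  have := nullSingletonClass_gaussianReal (μ := 0) (v := 1) one_ne_zero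
  have h1 : (gaussianReal 0 1).real (Set.Iic 0) = (gaussianReal 0 1).real (Set.Ioi 0) := by
    have e : (gaussianReal 0 1).map (fun x => -x) = gaussianReal 0 1 := by
      simpa using gaussianReal_map_neg (μ := 0) (v := 1)
    have h := map_measureReal_apply (μ := gaussianReal 0 1) (f := fun x : ℝ => -x) measurable_neg
      (measurableSet_Iic (a := (0 : ℝ)))
    rw [e] at h
    rw [h, measureReal_congr (Ioi_ae_eq_Ici (μ := gaussianReal 0 1))]
    congr 1
    ext x
    simp
  have h2 := probReal_add_probReal_compl (μ := gaussianReal 0 1) (measurableSet_Iic (a := (0 : ℝ)))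
  rw [Set.compl_Iic] at h2
  rw [cdf_eq_real]
  linarith

theorem lt_of_le_cdf_gaussianReal {α x : ℝ} (hα : α < 1 / 2)
    (hx : 1 - α ≤ cdf (gaussianReal 0 1) x) : 0 < x := by
  by_contra h
  have := monotone_cdf (gaussianReal 0 1) (not_lt.1 h)
  rw [cdf_gaussianReal_zero] at this
  linarith

/-- The cdf is `1/2 < 1 - α` at `0`; by right continuity it stays below `1 - α` slightly to the
right, which makes the infimum strictly positive. -/
theorem normalQuantile_pos {α : ℝ} (hα : α ∈ Set.Ioo (0 : ℝ) (1 / 2)) : 0 < normalQuantile α := by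
  have h0 : cdf (gaussianReal 0 1) 0 < 1 - α := by
    rw [cdf_gaussianReal_zero]
    linarith [hα.2]
  have hc := ((cdf (gaussianReal 0 1)).right_continuous 0).eventually_lt continuousWithinAt_const h0
  obtain ⟨x, hx0, hx⟩ : ∃ x, 0 < x ∧ cdf (gaussianReal 0 1) x < 1 - α := by
    have := (hc.filter_mono (nhdsWithin_mono 0 Set.Ioi_subset_Ici_self)).and self_mem_nhdsWithin
    obtain ⟨x, h1, h2⟩ := this.exists
    exact ⟨x, h2, h1⟩
  have hne : {x : ℝ | 1 - α ≤ cdf (gaussianReal 0 1) x}.Nonempty := by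
    have := (tendsto_cdf_atTop (gaussianReal 0 1)).eventually_const_le
      (show 1 - α < 1 by linarith [hα.1])
    exact this.exists
  refine hx0.trans_le (le_csInf hne fun y hy => ?_)
  by_contra h
  have := monotone_cdf (gaussianReal 0 1) (not_le.1 h).le
  have hy' : 1 - α ≤ cdf (gaussianReal 0 1) y := hy
  linarith

theorem lt_gaussianReal_Ioi {α x : ℝ} (hα : α < 1 / 2) (hx : x < normalQuantile α) :
    α < (gaussianReal 0 1).real (Set.Ioi x) := by
  have h := notMem_of_lt_csInf hx ⟨0, fun y hy => (lt_of_le_cdf_gaussianReal hα hy).le⟩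
  have h1 : cdf (gaussianReal 0 1) x < 1 - α := not_le.1 h
  have h2 := probReal_add_probReal_compl (μ := gaussianReal 0 1) (measurableSet_Iic (a := x))
  rw [Set.compl_Iic, ← cdf_eq_real] at h2
  linarith

theorem gaussianReal_Ioi_le {x : ℝ} (hx : 0 < x) :
    (gaussianReal 0 1).real (Set.Ioi x) ≤ 1 / x ^ 2 := by
  have h := meas_ge_le_variance_div_sq (μ := gaussianReal 0 1) (X := id)
    (memLp_id_gaussianReal 2) hx
  rw [variance_id_gaussianReal] at h
  have h1 : gaussianReal 0 1 (Set.Ioi x) ≤ ENNReal.ofReal (1 / x ^ 2) := by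
    refine (measure_mono (t := {y | x ≤ |y|}) fun y hy => ?_).trans (by simpa using h)
    have hy' : x < y := hy
    exact hy'.le.trans (le_abs_self y)
  exact ENNReal.toReal_le_of_le_ofReal (by positivity) h1

/-- Chebyshev's inequality for the normal law is applied at `0.9 z`, where the upper tail still
exceeds `α`; the loss `1 / 0.81` is below `2`. -/
theorem le_two_div_normalQuantile_sq {α : ℝ} (hα : α ∈ Set.Ioo (0 : ℝ) (1 / 2)) :
    α ≤ 2 / normalQuantile α ^ 2 := by
  have hz := normalQuantile_pos hα
  have h1 := lt_gaussianReal_Ioi hα.2 (x := 0.9 * normalQuantile α) (by linarith)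
  refine (h1.le.trans (gaussianReal_Ioi_le (by positivity))).trans ?_
  rw [div_le_div_iff₀ (by positivity) (by positivity)]
  nlinarith [sq_nonneg (normalQuantile α)]

/-! ### The threshold forced by the level, and the power of the test -/

/-- Chebyshev's inequality for the sum of squares of independent Skellam variables. -/
theorem measureReal_lt_sum_sq_skellam_le {ι : Type*} [Fintype ι] (a : ℝ≥0) (b : ι → ℝ≥0)
    (S : Finset ι) (hS : ∀ j, j ∉ S → b j = a) (hb : ∀ j, |(a : ℝ) - b j| ≤ a / 2) {n t : ℝ}
    (hn : Fintype.card ι * (a : ℝ) = n) (hsum : ∑ j, (b j : ℝ) ≤ n)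
    (ht : 2 * n + S.card * ((a : ℝ) ^ 2 / 4) < t) :
    (Measure.pi fun j => skellam a (b j)).real {y | t < ∑ j, y j ^ 2}
      ≤ (Fintype.card ι * (8 * (a : ℝ) ^ 2 + 2 * a)
          + S.card * (5 / 2 * (a : ℝ) ^ 3 + 11 / 2 * (a : ℝ) ^ 2 + 1 / 2 * a))
        / (t - (2 * n + S.card * ((a : ℝ) ^ 2 / 4))) ^ 2 := by
  classical
  have ha : (0 : ℝ) ≤ a := a.2
  set μ := Measure.pi fun j => skellam a (b j) with hμ
  set X : (ι → ℝ) → ℝ := ∑ j, fun y => y j ^ 2 with hX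
  have hXe : ∀ y, X y = ∑ j, y j ^ 2 := fun y => by simp [hX]
  have hLp : ∀ j, MemLp (fun y : ι → ℝ => y j ^ 2) 2 μ := fun j =>
    (memLp_sq_skellam a (b j)).comp_measurePreserving (measurePreserving_eval _ j)
  have hXLp : MemLp X 2 μ := memLp_finsetSum' _ fun j _ => hLp j
  have hδ : ∀ j, ((a : ℝ) - b j) ^ 2 ≤ if j ∈ S then (a : ℝ) ^ 2 / 4 else 0 := fun j => by
    split_ifs with h
    · have := sq_le_sq' (abs_le.1 (hb j)).1 (abs_le.1 (hb j)).2
      linarith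
    · simp [hS j h]
  have hmean : μ[X] ≤ 2 * n + S.card * ((a : ℝ) ^ 2 / 4) := by
    have e : ∀ j, ∫ y, y j ^ 2 ∂μ = ((a : ℝ) - b j) ^ 2 + (a + b j) := fun j => by
      rw [← integral_sq_skellam]
      have h := (measurePreserving_eval (fun j => skellam a (b j)) j).map_eq
      rw [← h, integral_map (measurable_pi_apply j).aemeasurable (by fun_prop)]
    simp_rw [hXe]
    rw [integral_finsetSum _ fun j _ => (hLp j).integrable (by norm_num)]
    simp_rw [e]
    -- The sums of `a` and of `b j` are each at most `n`, which gives `2 * n`; only the bins in `S`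
    -- contribute squared differences.
    rw [Finset.sum_add_distrib, Finset.sum_add_distrib]
    have h1 := Finset.sum_le_sum fun j (_ : j ∈ Finset.univ) => hδ j
    simp at h1
    simp
    linarith
  have hvar : Var[X; μ] ≤ Fintype.card ι * (8 * (a : ℝ) ^ 2 + 2 * a)
      + S.card * (5 / 2 * (a : ℝ) ^ 3 + 11 / 2 * (a : ℝ) ^ 2 + 1 / 2 * a) := by
    rw [hX, hμ, variance_sum_pi (X := fun _ x => x ^ 2) fun j => memLp_sq_skellam a (b j)]
    -- On `S`, `(a - b)² ≤ a² / 4` and `a + b ≤ 5a / 2` bound the variance by `5/2 a³ + 27/2 a² +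
    -- 5/2 a`; the null value `8a² + 2a` is split off.
    have h1 : ∀ j, Var[fun x : ℝ => x ^ 2; skellam a (b j)] ≤ (8 * (a : ℝ) ^ 2 + 2 * a)
        + if j ∈ S then 5 / 2 * (a : ℝ) ^ 3 + 11 / 2 * (a : ℝ) ^ 2 + 1 / 2 * a else 0 := fun j => by
      rw [variance_sq_skellam]
      have h2 := hδ j
      split_ifs with h
      · rw [if_pos h] at h2
        have h3 := (abs_le.1 (hb j)).1
        have h4 : (a : ℝ) + b j ≤ 5 / 2 * a := by linarith
        have h5 : (0 : ℝ) ≤ b j := (b j).2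
        have h6 : ((a : ℝ) - b j) ^ 2 * (a + b j) ≤ (a : ℝ) ^ 2 / 4 * (5 / 2 * a) := by gcongr
        have h7 : ((a : ℝ) + b j) ^ 2 ≤ (5 / 2 * a) ^ 2 := by gcongr
        nlinarith
      · rw [hS j h]
        nlinarith
    refine (Finset.sum_le_sum fun j _ => h1 j).trans (le_of_eq ?_)
    rw [Finset.sum_add_distrib, Finset.sum_const, Finset.card_univ, nsmul_eq_mul,
      Finset.sum_ite_mem, Finset.univ_inter, Finset.sum_const, nsmul_eq_mul]
  set c := t - (2 * n + S.card * ((a : ℝ) ^ 2 / 4)) with hc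
  have hcp : 0 < c := by linarith
  have hch := meas_ge_le_variance_div_sq hXLp hcp
  have hsub : {y : ι → ℝ | t < ∑ j, y j ^ 2} ⊆ {y | c ≤ |X y - μ[X]|} := fun y hy => by
    have hy' : t < ∑ j, y j ^ 2 := hy
    refine le_trans (b := X y - μ[X]) ?_ (le_abs_self _)
    rw [hXe]
    linarith
  have h3 : μ.real {y : ι → ℝ | t < ∑ j, y j ^ 2} ≤ Var[X; μ] / c ^ 2 :=
    ENNReal.toReal_le_of_le_ofReal (div_nonneg (variance_nonneg _ _) (sq_nonneg _))
      ((measure_mono hsub).trans hch)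
  refine h3.trans ?_
  gcongr

theorem measureReal_Ioi_stdSumLaw {ι : Type*} [Fintype ι] [Nonempty ι] {a : ℝ≥0} (ha : 0 < a)
    (x : ℝ) : (stdSumLaw ι a).real (Set.Ioi x) = (Measure.pi fun _ : ι => skellam a a).real
      {y | 2 * (Fintype.card ι * (a : ℝ)) + x * nullSD (Fintype.card ι) a < ∑ j, y j ^ 2} := by
  have hR : (0 : ℝ) < Fintype.card ι := by exact_mod_cast Fintype.card_pos
  have ha' : (0 : ℝ) < a := ha
  have hσ : 0 < nullSD (Fintype.card ι) a := Real.sqrt_pos.2 (by positivity)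
  rw [stdSumLaw, map_measureReal_apply (by fun_prop) measurableSet_Ioi]
  congr 1
  ext y
  simp only [Set.mem_preimage, Set.mem_Ioi, Set.mem_ofPred_eq]
  rw [← Finset.sum_div, lt_div_iff₀ hσ, Finset.sum_sub_distrib]
  simp only [Finset.sum_const, Finset.card_univ, nsmul_eq_mul]
  constructor <;> intro h <;> linarith

/-- The relative size of the mean shift and of the excess variance caused by an alternative on a
cube of side `1/m`. -/
theorem shift_and_variance_le {d : ℕ} (hd : 1 ≤ d) {x μ R a s : ℝ} (hx : 1 ≤ x)
    (hμ : 100 ^ d * x ^ 2 ≤ μ) (hR : μ ≤ R) (ha : R * a = x ^ 3) (hs0 : 0 ≤ s)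
    (hs : s ≤ 2 ^ d / μ * R) :
    s * (a ^ 2 / 4) ≤ 0.01 * √(R * (8 * a ^ 2 + 2 * a)) ∧
    R * (8 * a ^ 2 + 2 * a) + s * (5 / 2 * a ^ 3 + 11 / 2 * a ^ 2 + 1 / 2 * a)
      ≤ 1.04 * (R * (8 * a ^ 2 + 2 * a)) := by
  set D : ℝ := 2 ^ d with hD
  set H : ℝ := 100 ^ d with hH
  have hD0 : 0 < D := by positivity
  have hH1 : 100 ≤ H := le_self_pow₀ (by norm_num) (by omega)
  have hHD : 50 * D ≤ H := by
    have e : H = 50 ^ d * D := by rw [hH, hD, ← mul_pow]; norm_num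
    have : (50 : ℝ) ≤ 50 ^ d := le_self_pow₀ (by norm_num) (by omega)
    rw [e]
    gcongr
  have hx0 : 0 < x := by linarith
  have hx2 : 1 ≤ x ^ 2 := one_le_pow₀ hx
  have hμH : H ≤ μ := le_trans (by nlinarith) hμ
  have hμ0 : 0 < μ := by linarith
  have hR0 : 0 < R := by linarith
  have ha0 : 0 < a := by
    have : 0 < R * a := by rw [ha]; positivity
    exact (pos_iff_pos_of_mul_pos this).1 hR0
  -- `κ` bounds the fraction of affected bins.
  set κ := D / μ with hκ
  have hκ0 : 0 < κ := by positivity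
  have hκμ : κ * μ = D := div_mul_cancel₀ _ hμ0.ne'
  have hκ1 : κ ≤ 0.02 := by
    rw [hκ, div_le_iff₀ hμ0]
    linarith
  have hxμ : 50 * D * x ^ 2 ≤ μ := le_trans (by gcongr) hμ
  have haμ : μ * a ≤ x ^ 3 := by rw [← ha]; gcongr
  have hκa : κ * a ≤ 0.02 := by
    have h1 : κ * a = D * (μ * a) / μ ^ 2 := by rw [hκ]; field_simp
    rw [h1, div_le_iff₀ (by positivity)]
    have h2 : D * (μ * a) ≤ D * x ^ 3 := by gcongr
    have h3 : x ≤ μ := by nlinarith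
    have h4 : 50 * D * x ^ 2 * x ≤ μ * μ := by gcongr
    nlinarith
  -- The decisive estimate: since `R ≥ μ`, the left side is at most `D² x⁶ / μ³`, which is where `μ
  -- ≳ x² = n ^ (2/3)`, the critical rate, is needed.
  have hκR : κ ^ 2 * (R * a ^ 2) ≤ 0.01 := by
    have h1 : R * a ^ 2 * μ ≤ x ^ 6 := by
      calc R * a ^ 2 * μ ≤ R * a ^ 2 * R := by gcongr
        _ = (R * a) ^ 2 := by ring
        _ = x ^ 6 := by rw [ha]; ring
    have h2 : κ ^ 2 * (R * a ^ 2) = D ^ 2 * (R * a ^ 2 * μ) / μ ^ 3 := by rw [hκ]; field_simp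
    rw [h2, div_le_iff₀ (by positivity)]
    have h3 : (50 * D * x ^ 2) ^ 2 * (100 * x ^ 2) ≤ μ ^ 2 * μ := by
      gcongr
      refine le_trans ?_ hμ
      gcongr
    have h4 : D ^ 2 * (R * a ^ 2 * μ) ≤ D ^ 2 * x ^ 6 := by gcongr
    nlinarith [sq_nonneg (D * x ^ 3)]
  constructor
  · rw [← div_le_iff₀' (by norm_num)]
    refine Real.le_sqrt_of_sq_le ?_
    have h1 : s * (a ^ 2 / 4) ≤ κ * R * (a ^ 2 / 4) := by gcongr
    have h2 : (s * (a ^ 2 / 4) / 0.01) ^ 2 ≤ (κ * R * (a ^ 2 / 4) / 0.01) ^ 2 := by gcongr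
    refine h2.trans ?_
    -- With `hκR` the right side is at most `6.25 R a²`, below the part `8 R a²` of the variance.
    have h3 : (κ * R * (a ^ 2 / 4) / 0.01) ^ 2 = 625 * (κ ^ 2 * (R * a ^ 2)) * (R * a ^ 2) := by
      ring
    rw [h3]
    have h4 : 0 < R * a ^ 2 := by positivity
    have h5 : 0 < R * a := by positivity
    nlinarith
  · have h0 : 0 ≤ 5 / 2 * a ^ 3 + 11 / 2 * a ^ 2 + 1 / 2 * a := by positivity
    have h1 : s * (5 / 2 * a ^ 3 + 11 / 2 * a ^ 2 + 1 / 2 * a)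
        ≤ κ * R * (5 / 2 * a ^ 3 + 11 / 2 * a ^ 2 + 1 / 2 * a) := by gcongr
    have h2 : κ * R * (5 / 2 * a ^ 3 + 11 / 2 * a ^ 2 + 1 / 2 * a)
        = (κ * a) * (5 / 2 * (R * a ^ 2)) + κ * (11 / 2 * (R * a ^ 2) + 1 / 2 * (R * a)) := by ring
    have h4 : 0 < R * a ^ 2 := by positivity
    have h5 : 0 < R * a := by positivity
    have h6 : (κ * a) * (5 / 2 * (R * a ^ 2)) ≤ 0.02 * (5 / 2 * (R * a ^ 2)) := by gcongr
    have h7 : κ * (11 / 2 * (R * a ^ 2) + 1 / 2 * (R * a))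
        ≤ 0.02 * (11 / 2 * (R * a ^ 2) + 1 / 2 * (R * a)) := by gcongr
    nlinarith

/-- If the test has level `α` for the uniform distribution, it is blind to the alternative on the
cube at the origin of side `1/m ≲ n^{-2/(3d)}`. -/
theorem exists_forall_rejectionProb_bumped_le {d : ℕ} (hd : 1 ≤ d) {α : ℝ}
    (hα : α ∈ Set.Ioo (0 : ℝ) (1 / 2)) : ∃ N : ℝ, 1 ≤ N ∧ ∀ n : ℝ≥0, N ≤ (n : ℝ) → ∀ M : ℕ, 1 ≤ M →
      ∀ t : ℝ, rejectionProb n (unif d) (unif d) M t ≤ α → ∀ (m : ℕ) (hm : 0 < m),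
        1 / (m : ℝ) ≤ 1 / 100 * (n : ℝ) ^ (-(2 / (3 * (d : ℝ)))) →
          rejectionProb n (unif d) (bumped m (originCell d hm)) M t
            ≤ 2 / normalQuantile α ^ 2 := by
  have hz := normalQuantile_pos hα
  set z := normalQuantile α with hzdef
  obtain ⟨N₀, hN₀⟩ := exists_forall_lt_stdSumLaw (0.9 * z) α
    (lt_gaussianReal_Ioi hα.2 (by linarith))
  -- The square serves `hKR`: since `n ^ 2 ≤ R ^ 3`, a value of `n` above `K ^ 2`, with `K = max 1
  -- N₀`, forces `R ≥ K`.
  refine ⟨max 1 N₀ ^ 2, one_le_pow₀ (le_max_left _ _), fun n hn M hM t ht m hm hmn => ?_⟩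
  have hM0 : 0 < M := hM
  -- For `z ≤ 1` the claimed bound exceeds `1`. Below, `z > 1` allows the shift `0.01 σ` to be
  -- absorbed into `0.01 z σ`.
  rcases le_or_gt z 1 with hz1 | hz1
  · rw [rejectionProb_eq]
    refine measureReal_le_one.trans ?_
    rw [le_div_iff₀ (by positivity)]
    nlinarith
  rcases le_or_gt M m with hMm | hMm
  · rw [rejectionProb_bumped_eq_of_le hm hM0 hMm]
    exact ht.trans (le_two_div_normalQuantile_sq hα)
  have : Nonempty (Fin M) := ⟨⟨0, hM0⟩⟩
  have hK1 : 1 ≤ max 1 N₀ := le_max_left _ _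
  have hn1 : 1 ≤ (n : ℝ) := le_trans (one_le_pow₀ hK1) hn
  have hn0 : (0 : ℝ) < n := by linarith
  have hm' : (0 : ℝ) < m := by exact_mod_cast hm
  have hM' : (0 : ℝ) < M := by exact_mod_cast hM0
  have hd' : (0 : ℝ) < d := by exact_mod_cast hd
  set x : ℝ := (n : ℝ) ^ (1 / 3 : ℝ) with hx
  have hx1 : 1 ≤ x := Real.one_le_rpow hn1 (by norm_num)
  have hx3 : x ^ 3 = n := by
    rw [hx, ← Real.rpow_natCast, ← Real.rpow_mul hn0.le]
    norm_num
  have hμ : 100 ^ d * x ^ 2 ≤ (m : ℝ) ^ d := by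
    have h1 : (n : ℝ) ^ (2 / (3 * (d : ℝ))) * 100 ≤ m := by
      rw [Real.rpow_neg hn0.le] at hmn
      have hp : 0 < (n : ℝ) ^ (2 / (3 * (d : ℝ))) := Real.rpow_pos_of_pos hn0 _
      have e : 1 / 100 * ((n : ℝ) ^ (2 / (3 * (d : ℝ))))⁻¹
          = 1 / ((n : ℝ) ^ (2 / (3 * (d : ℝ))) * 100) := by
        field_simp
      rw [e] at hmn
      exact (one_div_le_one_div hm' (by positivity)).1 hmn
    have h2 : ((n : ℝ) ^ (2 / (3 * (d : ℝ)))) ^ d = x ^ 2 := by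
      rw [hx, ← Real.rpow_natCast, ← Real.rpow_mul hn0.le, ← Real.rpow_natCast,
        ← Real.rpow_mul hn0.le]
      congr 1
      field_simp
      norm_num
    rw [← h2, mul_comm, ← mul_pow]
    gcongr
  set R : ℝ := (M : ℝ) ^ d with hR
  have hR0 : 0 < R := by positivity
  have hμR : (m : ℝ) ^ d ≤ R := by
    rw [hR]
    have : (m : ℝ) ≤ M := by exact_mod_cast hMm.le
    gcongr
  have hcard : (Fintype.card (Fin d → Fin M) : ℝ) = R := by simp [hR]
  set a : ℝ≥0 := n * unif d (cell M fun _ => ⟨0, hM0⟩) with ha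
  have haj : ∀ j : Fin d → Fin M, n * unif d (cell M j) = a := fun j => by
    rw [ha]
    congr 1
    exact NNReal.coe_injective ((unif_cell hM0 j).trans (unif_cell hM0 _).symm)
  have haR : (a : ℝ) = n / R := by
    rw [ha, NNReal.coe_mul, unif_cell hM0, hR]
    ring
  have hRa : R * a = n := by
    rw [haR]
    field_simp
  have ha0 : 0 < a := by
    have : (0 : ℝ) < a := by rw [haR]; positivity
    exact this
  have ha0' : (0 : ℝ) < a := ha0
  have hKR : max 1 N₀ ≤ R := by
    by_contra h
    push Not at h
    have h1 : x ^ 2 ≤ R := by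
      refine le_trans ?_ (hμ.trans hμR)
      exact le_mul_of_one_le_left (by positivity) (one_le_pow₀ (by norm_num))
    have h2 : (n : ℝ) ^ 2 ≤ R ^ 3 := by
      rw [← hx3]
      calc (x ^ 3) ^ 2 = (x ^ 2) ^ 3 := by ring
        _ ≤ R ^ 3 := by gcongr
    have h3 : R ^ 3 < max 1 N₀ ^ 3 := by gcongr
    have h4 : max 1 N₀ ^ 3 ≤ max 1 N₀ ^ 4 := pow_le_pow_right₀ hK1 (by norm_num)
    have h5 : (max 1 N₀ ^ 2) ^ 2 ≤ (n : ℝ) ^ 2 := by gcongr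
    nlinarith
  have hlt := hN₀ (Fin d → Fin M) a ha0 (by
      rw [hcard]
      exact (le_max_right _ _).trans hKR) (by
      rw [hcard, hRa]
      exact (le_max_right _ _).trans ((le_self_pow₀ hK1 (by norm_num)).trans hn))
  rw [measureReal_Ioi_stdSumLaw ha0, hcard, hRa] at hlt
  set σ := nullSD (Fintype.card (Fin d → Fin M)) a with hσ
  have hσe : σ = √(R * (8 * (a : ℝ) ^ 2 + 2 * a)) := by rw [hσ, nullSD, hcard]
  have hσ2 : σ ^ 2 = R * (8 * (a : ℝ) ^ 2 + 2 * a) := by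
    rw [hσe]
    exact Real.sq_sqrt (by positivity)
  have hσp : 0 < σ := by
    rw [hσe]
    exact Real.sqrt_pos.2 (by positivity)
  -- A smaller threshold would give a null rejection probability above `α`, by the central limit
  -- theorem.
  have hthr : 2 * n + 0.9 * z * σ ≤ t := by
    by_contra h
    push Not at h
    rw [rejectionProb_eq_pi n _ _ hM0] at ht
    simp_rw [haj] at ht
    refine absurd hlt (not_lt.2 (le_trans (measureReal_mono fun y hy => ?_) ht))
    exact h.trans hy
  obtain ⟨hshift, hvar⟩ := shift_and_variance_le hd (μ := (m : ℝ) ^ d) (R := R) (a := a)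
    (s := (affectedBins d m M).card) hx1 hμ hμR (by rw [hRa, hx3]) (Nat.cast_nonneg _)
    (card_affectedBins_le hm hMm.le)
  rw [← hσe] at hshift
  rw [← hσ2] at hvar
  have hgap : 0.89 * z * σ ≤ t - (2 * n + (affectedBins d m M).card * ((a : ℝ) ^ 2 / 4)) := by
    nlinarith
  have hcheb := measureReal_lt_sum_sq_skellam_le a
    (fun j : Fin d → Fin M => n * bumped m (originCell d hm) (cell M j)) (affectedBins d m M)
    (fun j hj => by rw [bumped_originCell_eq_of_notMem hm hM0 j hj, haj])
    (fun j => by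
      rw [← haj j, NNReal.coe_mul, NNReal.coe_mul, ← mul_sub, abs_mul, abs_of_pos hn0, mul_div_assoc]
      gcongr
      exact abs_bumped_cell_sub_le _ _)
    (n := n) (t := t) (by rw [hcard, hRa])
    (by
      simp_rw [NNReal.coe_mul]
      rw [← Finset.mul_sum]
      exact mul_le_of_le_one_right hn0.le (sum_bumped_cell_le hM0 _))
    (by
      have : 0 < 0.89 * z * σ := by positivity
      linarith)
  rw [hcard, ← hσ2] at hcheb
  rw [rejectionProb_eq_pi n _ _ hM0]
  simp_rw [haj]
  refine hcheb.trans ?_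
  have hp : 0 < 0.89 * z * σ := by positivity
  calc _ ≤ 1.04 * σ ^ 2 / (0.89 * z * σ) ^ 2 := by gcongr
    _ = 1.04 / 0.89 ^ 2 / z ^ 2 := by field_simp
    _ ≤ 2 / z ^ 2 := by
        gcongr
        norm_num

end ChiSq

/-! ### The two claims -/

theorem theorem3 (d : ℕ) (hd : 1 ≤ d) :
    ∃ c : ℝ, 0 < c ∧ ∀ α ∈ Set.Ioo (0 : ℝ) (1 / 2), ∃ N : ℝ, ∀ n : ℝ≥0, N ≤ (n : ℝ) →
      ∀ M : ℕ, 1 ≤ M → ∀ t : ℝ,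
        ChiSq.rejectionProb n (ChiSq.unif d) (ChiSq.unif d) M t ≤ α →
        (∀ m : ℕ, 1 ≤ m → 1 / (m : ℝ) ≤ c * (n : ℝ) ^ (-(2 / (3 * (d : ℝ)))) →
          ∃ PQ ∈ ChiSq.localizedFamily d m,
            ChiSq.rejectionProb n PQ.1 PQ.2 M t ≤ 2 / ChiSq.normalQuantile α ^ 2) ∧
        (∀ ρ : ℝ, ρ ≤ c * (n : ℝ) ^ (-(2 / (3 * (d : ℝ)))) →
          ∃ PQ : ProbabilityMeasure (Fin d → ℝ) × ProbabilityMeasure (Fin d → ℝ),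
            (∀ B : ℝ, 2 ≤ B → PQ ∈ ChiSq.regularClass d B) ∧ (ρ : EReal) ≤ ChiSq.dBV PQ.1 PQ.2 ∧
            ChiSq.rejectionProb n PQ.1 PQ.2 M t ≤ 2 / ChiSq.normalQuantile α ^ 2) := by
  have hd' : (1 : ℝ) ≤ d := by exact_mod_cast hd
  -- `1600 d = 8d * 200`: the factor `8d` comes from `le_dBV_bumped`, and `200` from the bound on `m
  -- * y` below. The constant is also at most `1 / 100`, as the power bound requires.
  refine ⟨1 / (1600 * d), by positivity, fun α hα => ?_⟩
  obtain ⟨N, hN1, hN⟩ := ChiSq.exists_forall_rejectionProb_bumped_le hd hα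
  refine ⟨N, fun n hn M hM t ht => ?_⟩
  have hn1 : (1 : ℝ) ≤ n := hN1.trans hn
  have hn0 : (0 : ℝ) < n := by linarith
  set y : ℝ := (n : ℝ) ^ (-(2 / (3 * (d : ℝ)))) with hy
  have hy0 : 0 < y := Real.rpow_pos_of_pos hn0 _
  have hy1 : y ≤ 1 := Real.rpow_le_one_of_one_le_of_nonpos hn1 (neg_nonpos.2 (by positivity))
  constructor
  · intro m hm hmn
    refine ⟨_, ⟨ChiSq.originCell d hm, rfl⟩, hN n hn M hM t ht m hm (hmn.trans ?_)⟩
    gcongr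
    linarith
  · intro ρ hρ
    -- The coarsest partition the power bound admits, to make the distance as large as possible;
    -- rounding up costs little because `y ≤ 1`.
    set m := ⌈100 / y⌉₊ with hmdef
    have hm1 : 100 / y ≤ m := Nat.le_ceil _
    have hm2 : (m : ℝ) ≤ 100 / y + 1 := (Nat.ceil_lt_add_one (by positivity)).le
    have hm0 : (0 : ℝ) < m := lt_of_lt_of_le (by positivity) hm1
    have hm : 0 < m := by exact_mod_cast hm0
    refine ⟨(ChiSq.unif d, ChiSq.bumped m (ChiSq.originCell d hm)),
      fun B hB => ChiSq.mem_regularClass _ hB, ?_, hN n hn M hM t ht m hm ?_⟩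
    · refine le_trans ?_ (ChiSq.le_dBV_bumped hd hm _)
      rw [EReal.coe_le_coe_iff]
      refine hρ.trans ?_
      have h1 : (m : ℝ) * y ≤ 200 := by
        have h2 : (m : ℝ) * y ≤ (100 / y + 1) * y := by gcongr
        have h3 : (100 / y + 1) * y = 100 + y := by field_simp
        linarith
      rw [div_mul_eq_mul_div, one_mul, div_le_div_iff₀ (by positivity) (by positivity)]
      nlinarith
    · rw [div_le_iff₀ hm0]
      rw [div_le_iff₀ hy0] at hm1
      nlinarith
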